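/- Let $K$ be a field, let $f_1,\dots,f_m\in K[x_1,\dots,x_n]$ be nonzero homogeneous polynomials, and let $<$ be a monomial order. A signature is a formal product $tF_i$ of a monomial $t$ and a symbol $F_i$, $1\le i\le m$; $tF_i\prec t'F_j$ means $i>j$, or $i=j$ and $t<t'$; $tF_i\mid t'F_j$ means $i=j$ and $t\mid t'$; $\mathrm{index}(tF_i)=i$, and the degree of $tF_i$ is $\deg t$. A labeled polynomial $r$ is a polynomial together with a signature $\mathcal S(r)$; $\mathrm{HM}(r)$ is the head monomial of its polynomial. Run the original (incremental) F5 algorithm of Faugère on $(f_1,\dots,f_m)$, the inputs being divided by their head coefficients and given the signatures $F_1,\dots,F_m$. It treats $f_m$ first and $f_1$ last; it keeps a list $R$ of labeled polynomials $r_1,r_2,\dots$ ($r_1,\dots,r_m$ being the inputs, each new element being appended at the end), the set $G_i$ computed in the call for $f_i$ (with $G_{m+1}=\emptyset$), and the sets $ToDo$, $Done$ of its reduction procedure. All choices that the algorithm leaves open may be made arbitrarily. Consider the moment in the call for $f_1$ just before a labeled polynomial $g$ is added to $Done$, and let $G_g=G_1\cup Done$ at this moment. For a monomial $s$ and $r_i\in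 G_g$: * $s r_i$ satisfies the F5 criterion if the monomial of $s\,\mathcal S(r_i)$ is not equal to its normal form with respect to $G_{k+1}$, where $k=\mathrm{index}(\mathcal S(r_i))$; * $s r_i$ satisfies the Rewritten criterion if $\mathcal S(r_j)\mid s\,\mathcal S(r_i)$ for some element $r_j$ of $R$ with $j>i$. For labeled polynomials $f,r$ with nonzero polynomials, $r$ is a signature-safe reductor for $f$ if $\mathrm{HM}(r)\mid\mathrm{HM}(f)$ and $\frac{\mathrm{HM}(f)}{\mathrm{HM}(r)}\mathcal S(r)\prec\mathcal S(f)$. **Statement.** Let $f$ be any labeled polynomial with nonzero polynomial, with no restriction on its signature. Suppose that $f$ has a signature-safe reductor $f'\in G_g$ with $\frac{\mathrm{HM}(f)}{\mathrm{HM}(f')}\mathcal S(f')\prec\mathcal S(g)$. Suppose further that $<$ is degree-compatible ($\deg t<\deg t'$ implies $t<t'$) or, more generally, that $\deg\bigl(\frac{\mathrm{HM}(f)}{\mathrm{HM}(f')}\mathcal S(f')\bigr)\le\deg\mathcal S(g)$ in case $\mathcal S(f')$ and $\mathcal S(g)$ have the same index. Then there is a signature-safe reductor $f''\in G_g$ for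 $f$ such that $\frac{\mathrm{HM}(f)}{\mathrm{HM}(f'')}f''$ satisfies neither the F5 criterion nor the Rewritten criterion. -/

import Mathlib

/-!
Labeled polynomials, signatures, and the F5 algorithm as a nondeterministic transition system.

Input polynomials, signature indices and calls of the incremental algorithm are numbered
`0, …, m - 1`: the number `i` stands for the `(i + 1)`-st input polynomial.  The algorithm treats
the last input first and call `0` last.  Every choice that the algorithm leaves open (or that a
sorting routine makes) is a free choice of the transition relation, so a statement about all
reachable states is a statement about every execution.
-/

namespace F5

open MvPolynomial

/-- A signature `t F_i`: a monomial `t` (given by its exponent vector) and an index `i`. -/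
structure Sig (n m : ℕ) where
  mon : Fin n →₀ ℕ
  idx : Fin m

namespace Sig

variable {n m : ℕ}

/-- The signature order `≺`: `t F_i ≺ t' F_j` iff `i > j`, or `i = j` and `t < t'`. -/
def Lt (mo : MonomialOrder (Fin n)) (a b : Sig n m) : Prop :=
  b.idx < a.idx ∨ (a.idx = b.idx ∧ mo.toSyn a.mon < mo.toSyn b.mon)

/-- The multiple of a signature by the monomial with exponent vector `u`. -/
noncomputable def mul (u : Fin n →₀ ℕ) (a : Sig n m) : Sig n m := ⟨u + a.mon, a.idx⟩

/-- Divisibility of signatures: same index, and the monomials divide. -/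
def Dvd (a b : Sig n m) : Prop := a.idx = b.idx ∧ a.mon ≤ b.mon

end Sig

/-- A labeled polynomial: a signature and a polynomial. -/
structure LabeledPoly (n m : ℕ) (K : Type*) [Field K] where
  sig : Sig n m
  poly : MvPolynomial (Fin n) K

/-- A critical pair `[t, u₁, r₁, u₂, r₂]`; the labeled polynomials are given by their positions. -/
structure CritPair (n : ℕ) where
  lcm : Fin n →₀ ℕ
  u₁ : Fin n →₀ ℕ
  pos₁ : ℕ
  u₂ : Fin n →₀ ℕ
  pos₂ : ℕ

section Polynomials

variable {n m : ℕ} {K : Type*} [Field K] (mo : MonomialOrder (Fin n))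

/-- The polynomial divided by its head coefficient. -/
noncomputable def monic (p : MvPolynomial (Fin n) K) : MvPolynomial (Fin n) K :=
  C (mo.leadingCoeff p)⁻¹ * p

/-- One reduction step modulo `B`: some monomial of `p` is a multiple of the head monomial of a
nonzero `b ∈ B` and is cancelled by subtracting a multiple of `b`. -/
def RedStep (B : Set (MvPolynomial (Fin n) K)) (p q : MvPolynomial (Fin n) K) : Prop :=
  ∃ b ∈ B, b ≠ 0 ∧ ∃ a : Fin n →₀ ℕ, a + mo.degree b ∈ p.support ∧
    q = p - monomial a (p.coeff (a + mo.degree b) / mo.leadingCoeff b) * b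

/-- `q` is a normal form of `p` with respect to `B`. -/
def IsNormalForm (B : Set (MvPolynomial (Fin n) K)) (p q : MvPolynomial (Fin n) K) : Prop :=
  Relation.ReflTransGen (RedStep mo B) p q ∧ ∀ q', ¬ RedStep mo B q q'

/-- The exponent vector of `HM(f) / HM(r)`, meaningful if `HM(r)` divides `HM(f)`. -/
noncomputable def ratio (f r : LabeledPoly n m K) : Fin n →₀ ℕ :=
  mo.degree f.poly - mo.degree r.poly

/-- `r` is a signature-safe reductor for `f`: `HM(r) ∣ HM(f)` and
`(HM(f) / HM(r)) S(r) ≺ S(f)`. -/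
def SignatureSafeReductor (f r : LabeledPoly n m K) : Prop :=
  r.poly ≠ 0 ∧ mo.degree r.poly ≤ mo.degree f.poly ∧
    Sig.Lt mo (Sig.mul (ratio mo f r) r.sig) f.sig

end Polynomials

/-- The control points of the algorithm. -/
inductive Phase
  /-- the head of the `while` loop of `AlgorithmF5` -/
  | loop
  /-- inside `Spol` -/
  | spol
  /-- the head of the `while` loop of `Reduction` -/
  | reduction
  /-- the `for` loop of `AlgorithmF5` over the output of `Reduction` -/
  | update

/-- A state of the algorithm.
* `call`: the number of the current call of `AlgorithmF5`;
* `R`, `N`: the array of labeled polynomials, of which positions `0, …, N - 1` are in use;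
  positions `0, …, m - 1` hold the inputs, and every new element is appended;
* `G k`: the positions in the set `G_k` of call `k` (and `G m = ∅`);
* `P`: the waiting critical pairs, `Pd`: those handed to `Spol` and not yet processed;
* `ToDo`, `Done`: the sets of positions in `Reduction`.  In phase `update`, `Done` holds the part
  of the output of `Reduction` that still has to be moved to `G`. -/
structure State (n m : ℕ) (K : Type*) [Field K] where
  call : Fin m
  phase : Phase
  R : ℕ → LabeledPoly n m K
  N : ℕ
  G : ℕ → Finset ℕ
  P : Set (CritPair n)
  Pd : Set (CritPair n)
  ToDo : Finset ℕ
  Done : Finset ℕ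

namespace State

variable {n m : ℕ} {K : Type*} [Field K] (mo : MonomialOrder (Fin n)) (s : State n m K)

/-- The polynomials of the set `G_k`. -/
def polys (k : ℕ) : Set (MvPolynomial (Fin n) K) := {p | ∃ i ∈ s.G k, (s.R i).poly = p}

/-- `φ_k(u) = u` for the monomial `u`, where `φ_k` is the normal form with respect to `G_k`. -/
def FixedByNF (k : ℕ) (u : Fin n →₀ ℕ) : Prop :=
  IsNormalForm mo (s.polys k) (monomial u (1 : K)) (monomial u (1 : K))

/-- The multiple `u r_i` satisfies the F5 criterion: its signature monomial is changed by the
normal form with respect to `G_{index(r_i) + 1}`. -/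
def SatisfiesF5 (u : Fin n →₀ ℕ) (i : ℕ) : Prop :=
  ¬ s.FixedByNF mo ((s.R i).sig.idx.val + 1) (Sig.mul u (s.R i).sig).mon

/-- The multiple `u r_i` satisfies the Rewritten criterion: the signature of some `r_j` with
`j > i` divides the signature of `u r_i`.  As a rule is recorded whenever an element is appended
to `R`, and rules are searched from the newest to the oldest among those with the index of `r_i`,
this is also the test `Rewritten?(u, r_i)` of the algorithm. -/
def SatisfiesRewritten (u : Fin n →₀ ℕ) (i : ℕ) : Prop :=
  ∃ j, i < j ∧ j < s.N ∧ Sig.Dvd (s.R j).sig (Sig.mul u (s.R i).sig)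

/-- The set `G ∪ Done` of the current call. -/
def basis : Finset ℕ := s.G s.call.val ∪ s.Done

/-- The multiplier of `r_a` in the critical pair of `r_a` and `r_b`. -/
noncomputable def cofactor (a b : ℕ) : Fin n →₀ ℕ :=
  mo.degree (s.R a).poly ⊔ mo.degree (s.R b).poly - mo.degree (s.R a).poly

open Classical in
/-- The critical pair of `r_a` and `r_b`, the part with the greater signature first. -/
noncomputable def orderedPair (a b : ℕ) : CritPair n :=
  let t := mo.degree (s.R a).poly ⊔ mo.degree (s.R b).poly
  if Sig.Lt mo (Sig.mul (s.cofactor mo a b) (s.R a).sig)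
      (Sig.mul (s.cofactor mo b a) (s.R b).sig) then
    ⟨t, s.cofactor mo b a, b, s.cofactor mo a b, a⟩
  else
    ⟨t, s.cofactor mo a b, a, s.cofactor mo b a, b⟩

/-- The output of `CritPair(r_a, r_b, k, φ_{k+1})` in call `k`: empty or one critical pair.  It is
empty if the index of the first part is greater than `k`, or if a part of index `k` has a
signature monomial that is changed by `φ_{k+1}`. -/
def critPair (a b : ℕ) : Set (CritPair n) :=
  {c | c = s.orderedPair mo a b ∧
    (s.R c.pos₁).sig.idx ≤ s.call ∧
    s.FixedByNF mo (s.call.val + 1) (Sig.mul c.u₁ (s.R c.pos₁).sig).mon ∧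
    ((s.R c.pos₂).sig.idx = s.call →
      s.FixedByNF mo (s.call.val + 1) (Sig.mul c.u₂ (s.R c.pos₂).sig).mon)}

/-- `u p - c v q` for the polynomials `p`, `q` at positions `i`, `j`, where `c` is the quotient of
the head coefficients (so `c = 1` for polynomials with head coefficient `1`). -/
noncomputable def spoly (u : Fin n →₀ ℕ) (i : ℕ) (v : Fin n →₀ ℕ) (j : ℕ) :
    MvPolynomial (Fin n) K :=
  monomial u 1 * (s.R i).poly -
    monomial v (mo.leadingCoeff (s.R i).poly / mo.leadingCoeff (s.R j).poly) * (s.R j).poly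

/-- Replace the polynomial at position `i`, keeping its signature. -/
def setPoly (i : ℕ) (p : MvPolynomial (Fin n) K) : State n m K :=
  { s with R := Function.update s.R i ⟨(s.R i).sig, p⟩ }

/-- Append a new labeled polynomial (and thereby its rule) and put it into `ToDo`. -/
def append (r : LabeledPoly n m K) : State n m K :=
  { s with R := Function.update s.R s.N r, N := s.N + 1, ToDo := insert s.N s.ToDo }

/-- `IsReducible` may return `r_j` as a reductor of `r_h`: the checks (a)-(d). -/
def IsReductor (h j : ℕ) : Prop :=
  j ∈ s.basis ∧
  mo.degree (s.R j).poly ≤ mo.degree (s.R h).poly ∧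
  s.FixedByNF mo (s.call.val + 1) (Sig.mul (ratio mo (s.R h) (s.R j)) (s.R j).sig).mon ∧
  ¬ s.SatisfiesRewritten (ratio mo (s.R h) (s.R j)) j ∧
  Sig.mul (ratio mo (s.R h) (s.R j)) (s.R j).sig ≠ (s.R h).sig

/-- `Reduction` takes `r_h`, of minimal signature, from `ToDo` and replaces its polynomial by a
normal form with respect to `G_{k+1}`; the result is the state `s₁`. -/
def Take (h : ℕ) (s₁ : State n m K) : Prop :=
  s.phase = Phase.reduction ∧ h ∈ s.ToDo ∧
  (∀ j ∈ s.ToDo, ¬ Sig.Lt mo (s.R j).sig (s.R h).sig) ∧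
  ∃ p, IsNormalForm mo (s.polys (s.call.val + 1)) (s.R h).poly p ∧ s₁ = s.setPoly h p

/-- The labeled polynomial `r_h` is taken from `ToDo`, is nonzero and has no reductor, so that it
is added to `Done` (with head coefficient `1`). -/
def AddToDone (h : ℕ) (s' : State n m K) : Prop :=
  ∃ s₁, s.Take mo h s₁ ∧ (s₁.R h).poly ≠ 0 ∧ (∀ j, ¬ s₁.IsReductor mo h j) ∧
    s' = { s₁.setPoly h (monic mo (s₁.R h).poly) with
      ToDo := s.ToDo.erase h, Done := insert h s.Done }

/-- The state at the start of the call of `AlgorithmF5` for the input polynomial `k`. -/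
def enterCall (k : Fin m) : State n m K :=
  { s with
    call := k
    phase := Phase.loop
    G := Function.update s.G k.val (insert k.val (s.G (k.val + 1)))
    P := ⋃ r ∈ s.G (k.val + 1), ({ s with call := k } : State n m K).critPair mo k.val r
    Pd := ∅
    ToDo := ∅
    Done := ∅ }

/-- The state before the first call: the inputs, made monic, are at positions `0, …, m - 1` with
signatures `F_0, …, F_{m-1}` (the value of `R` at unused positions is irrelevant). -/
noncomputable def start (f : Fin m → MvPolynomial (Fin n) K) (k : Fin m) : State n m K where
  call := k
  phase := Phase.loop
  R := fun i => if h : i < m then ⟨⟨0, ⟨i, h⟩⟩, monic mo (f ⟨i, h⟩)⟩ else ⟨⟨0, k⟩, 0⟩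
  N := m
  G := fun _ => ∅
  P := ∅
  Pd := ∅
  ToDo := ∅
  Done := ∅

end State

open State in
/-- One step of the algorithm. -/
inductive Step {n m : ℕ} {K : Type*} [Field K] (mo : MonomialOrder (Fin n)) :
    State n m K → State n m K → Prop
  /-- All pairs of minimal degree are handed to `Spol`. -/
  | select (s : State n m K) (d : ℕ) (hph : s.phase = Phase.loop)
      (hd : ∃ c ∈ s.P, c.lcm.degree = d) (hmin : ∀ c ∈ s.P, d ≤ c.lcm.degree) :
      Step mo s { s with
        phase := Phase.spol
        P := {c ∈ s.P | c.lcm.degree ≠ d}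
        Pd := {c ∈ s.P | c.lcm.degree = d}
        ToDo := ∅
        Done := ∅ }
  /-- `Spol` discards a pair with a rewritten part. -/
  | spolReject (s : State n m K) (c : CritPair n) (hph : s.phase = Phase.spol) (hc : c ∈ s.Pd)
      (hrew : s.SatisfiesRewritten c.u₁ c.pos₁ ∨ s.SatisfiesRewritten c.u₂ c.pos₂) :
      Step mo s { s with Pd := s.Pd \ {c} }
  /-- `Spol` computes an S-polynomial. -/
  | spolCompute (s : State n m K) (c : CritPair n) (hph : s.phase = Phase.spol) (hc : c ∈ s.Pd)
      (hrew₁ : ¬ s.SatisfiesRewritten c.u₁ c.pos₁) (hrew₂ : ¬ s.SatisfiesRewritten c.u₂ c.pos₂) :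
      Step mo s { s.append ⟨Sig.mul c.u₁ (s.R c.pos₁).sig,
          s.spoly mo c.u₁ c.pos₁ c.u₂ c.pos₂⟩ with Pd := s.Pd \ {c} }
  /-- `Spol` returns and `Reduction` is called. -/
  | spolReturn (s : State n m K) (hph : s.phase = Phase.spol) (hPd : s.Pd = ∅) :
      Step mo s { s with phase := Phase.reduction }
  /-- The element taken from `ToDo` is zero and is dropped. -/
  | reduceZero (s s₁ : State n m K) (h : ℕ) (ht : s.Take mo h s₁) (h0 : (s₁.R h).poly = 0) :
      Step mo s { s₁ with ToDo := s.ToDo.erase h }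
  /-- The element taken from `ToDo` has no reductor and is added to `Done`. -/
  | addToDone (s s' : State n m K) (h : ℕ) (ha : s.AddToDone mo h s') : Step mo s s'
  /-- The element taken from `ToDo` is reduced by a signature-safe reductor and put back. -/
  | reduceSafe (s s₁ : State n m K) (h j : ℕ) (ht : s.Take mo h s₁) (h0 : (s₁.R h).poly ≠ 0)
      (hj : s₁.IsReductor mo h j)
      (hsafe : Sig.Lt mo (Sig.mul (ratio mo (s₁.R h) (s₁.R j)) (s₁.R j).sig) (s₁.R h).sig) :
      Step mo s (s₁.setPoly h (s₁.spoly mo 0 h (ratio mo (s₁.R h) (s₁.R j)) j))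
  /-- The reductor is not signature-safe: the element taken from `ToDo` is put back, and the
  S-polynomial, whose signature comes from the reductor, is added to `ToDo`. -/
  | reduceSpawn (s s₁ : State n m K) (h j : ℕ) (ht : s.Take mo h s₁) (h0 : (s₁.R h).poly ≠ 0)
      (hj : s₁.IsReductor mo h j)
      (hns : ¬ Sig.Lt mo (Sig.mul (ratio mo (s₁.R h) (s₁.R j)) (s₁.R j).sig) (s₁.R h).sig) :
      Step mo s (s₁.append ⟨Sig.mul (ratio mo (s₁.R h) (s₁.R j)) (s₁.R j).sig,
        s₁.spoly mo (ratio mo (s₁.R h) (s₁.R j)) j 0 h⟩)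
  /-- `Reduction` returns. -/
  | reductionReturn (s : State n m K) (hph : s.phase = Phase.reduction) (hT : s.ToDo = ∅) :
      Step mo s { s with phase := Phase.update }
  /-- An element of the output of `Reduction` is paired with the elements of `G` and added to it. -/
  | update (s : State n m K) (r : ℕ) (hph : s.phase = Phase.update) (hr : r ∈ s.Done) :
      Step mo s { s with
        P := s.P ∪ ⋃ q ∈ s.G s.call.val, s.critPair mo r q
        G := Function.update s.G s.call.val (insert r (s.G s.call.val))
        Done := s.Done.erase r }
  /-- The output of `Reduction` is exhausted: back to the head of the `while` loop. -/
  | updateReturn (s : State n m K) (hph : s.phase = Phase.update) (hD : s.Done = ∅) :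
      Step mo s { s with phase := Phase.loop }
  /-- `AlgorithmF5` returns, no polynomial of its output is `1`, and the next call begins. -/
  | nextCall (s : State n m K) (k : Fin m) (hph : s.phase = Phase.loop) (hP : s.P = ∅)
      (hk : k.val + 1 = s.call.val) (h1 : ∀ i ∈ s.G s.call.val, (s.R i).poly ≠ 1) :
      Step mo s (s.enterCall mo k)

/-- The states that occur in executions of the algorithm on the input `f 0, …, f (m - 1)`.  The
first call is the one for the last input polynomial, with `G m = ∅`. -/
inductive Reachable {n m : ℕ} {K : Type*} [Field K] (mo : MonomialOrder (Fin n))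
    (f : Fin m → MvPolynomial (Fin n) K) : State n m K → Prop
  | init (k : Fin m) (hk : k.val + 1 = m) : Reachable mo f ((State.start mo f k).enterCall mo k)
  | step (s s' : State n m K) (hs : Reachable mo f s) (hstep : Step mo s s') : Reachable mo f s'

/-- The monomial order is degree-compatible. -/
def DegreeCompatible {n : ℕ} (mo : MonomialOrder (Fin n)) : Prop :=
  ∀ a b : Fin n →₀ ℕ, a.degree < b.degree → mo.toSyn a < mo.toSyn b

end F5

/-! Every labeled polynomial `r` that occurs is `Admissible`: if its signature is `t F_k`, its
polynomial is a nonzero multiple of `t f_k` plus a combination of products `t' f_l` of smaller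
signature. Call a multiple `u r` of a basis element good if it satisfies neither criterion. Two
facts carry the proof.

(1) `gen_mem_span_goodMultiples`: if `τ = t F_k ≺ S(g)`, then `t f_k` is a `K`-linear combination of
good multiples of signature at most `τ`. This is an induction on `τ`. Let `r` be the newest element
of `R` whose signature divides `τ`, and `u r` its multiple of signature `τ`; by admissibility it may
replace `t f_k`. It is not rewritten, because `r` is the newest. If it satisfies the F5 criterion, a
principal syzygy pushes `t f_k` below `τ`. Otherwise `r` is zero, or `u r` is good, or `r` is in
`ToDo`; the last is impossible because `S(g)` is minimal there.

(2) `eq_of_degree_eq`: good multiples of degree at most the current degree `d` have distinct head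
monomials. A coincidence would come from a critical pair of degree at most `d`; such a pair is no
longer waiting, so one of its parts satisfies a criterion, and so do the multiples of that part. If
both elements have index above the current call, their pairs were settled in earlier calls and no
bound on the degree is needed; the degree hypothesis serves only the other case.

Apply (1) to the multiple of `f'` with head monomial `HM(f)`, and keep only the good multiples of
its own degree. By (2) their head monomials cannot cancel, so `HM(f)` is the head monomial of one of
them (`exists_goodMultiple`). This gives `f''`, and its multiple has signature at most that of the
multiple of `f'`, hence below `S(f)`.

The facts about the algorithm used here form `Invariant`, which every step preserves. -/

namespace F5

open MvPolynomial

/-! ### The order on signatures. -/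

namespace Sig

variable {n m : ℕ} {mo : MonomialOrder (Fin n)}

/-- The signature order as a lexicographic order. -/
noncomputable def key (mo : MonomialOrder (Fin n)) (a : Sig n m) : (Fin m)ᵒᵈ ×ₗ mo.syn :=
  toLex (OrderDual.toDual a.idx, mo.toSyn a.mon)

theorem lt_iff_key {a b : Sig n m} : Lt mo a b ↔ key mo a < key mo b := by
  simp [Lt, key, Prod.Lex.toLex_lt_toLex]

theorem key_injective : Function.Injective (key mo : Sig n m → _) := by
  rintro ⟨a, i⟩ ⟨b, j⟩ h
  simpa [key, and_comm] using h

theorem Lt.trans {a b c : Sig n m} (h : Lt mo a b) (h' : Lt mo b c) : Lt mo a c := by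
  rw [lt_iff_key] at *
  exact lt_trans h h'

theorem Lt.asymm {a b : Sig n m} (h : Lt mo a b) : ¬ Lt mo b a := by
  rw [lt_iff_key] at *
  exact h.asymm

/-- Since `key` makes the order total, `¬ Lt mo a b` serves throughout as the weak inequality `b ≼
a`. -/
theorem lt_or_eq_of_not_lt {a b : Sig n m} (h : ¬ Lt mo a b) : Lt mo b a ∨ b = a := by
  rw [lt_iff_key] at *
  exact (lt_or_eq_of_le (not_lt.1 h)).imp_right (fun h => key_injective h)

theorem lt_of_not_lt_of_lt {a b c : Sig n m} (h : ¬ Lt mo b a) (h' : Lt mo b c) : Lt mo a c := by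
  rw [lt_iff_key] at *
  exact (not_lt.1 h).trans_lt h'

theorem not_lt_of_lt_of_not_lt {a b c : Sig n m} (h : Lt mo a b) (h' : ¬ Lt mo c b) :
    Lt mo a c := by
  rw [lt_iff_key] at *
  exact h.trans_le (not_lt.1 h')

theorem not_lt_trans {a b c : Sig n m} (h : ¬ Lt mo b a) (h' : ¬ Lt mo c b) : ¬ Lt mo c a := by
  rw [lt_iff_key] at *
  exact not_lt.2 ((not_lt.1 h).trans (not_lt.1 h'))

theorem not_lt_self (a : Sig n m) : ¬ Lt mo a a := by
  rw [lt_iff_key]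
  exact lt_irrefl _

theorem Lt.mul {a b : Sig n m} (u : Fin n →₀ ℕ) (h : Lt mo a b) :
    Lt mo (Sig.mul u a) (Sig.mul u b) := by
  rcases h with h | ⟨h, h'⟩
  · exact Or.inl h
  · exact Or.inr ⟨h, by simpa [Sig.mul] using h'⟩

theorem not_lt_of_dvd {a b : Sig n m} (h : Dvd a b) : ¬ Lt mo b a := by
  rintro (h' | ⟨-, h'⟩)
  · rw [h.1] at h'
    exact lt_irrefl _ h'
  · exact not_lt.2 (mo.toSyn_monotone h.2) h'

theorem idx_le_of_not_lt {a b : Sig n m} (h : ¬ Lt mo a b) : a.idx ≤ b.idx := by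
  by_contra h'
  exact h (Or.inl (not_le.1 h'))

/-- There are finitely many indices, and monomial orders are well-orders. This permits induction on
signatures. -/
theorem lt_wellFounded : WellFounded (Lt mo : Sig n m → Sig n m → Prop) := by
  have : (Lt mo : Sig n m → Sig n m → Prop) = InvImage (· < ·) (key mo) := by
    funext a b
    exact propext lt_iff_key
  rw [this]
  exact InvImage.wf _ wellFounded_lt

@[simp] theorem mul_zero (a : Sig n m) : mul 0 a = a := by simp [mul]

@[simp] theorem mul_mon (u : Fin n →₀ ℕ) (a : Sig n m) : (mul u a).mon = u + a.mon := rfl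

@[simp] theorem mul_idx (u : Fin n →₀ ℕ) (a : Sig n m) : (mul u a).idx = a.idx := rfl

theorem mul_sub_of_dvd {a b : Sig n m} (h : Dvd a b) : mul (b.mon - a.mon) a = b := by
  obtain ⟨x, i⟩ := a
  obtain ⟨y, j⟩ := b
  obtain ⟨h1, h2⟩ := h
  simp only at h1 h2
  subst h1
  simp [mul, tsub_add_cancel_of_le h2]

theorem mul_mono {a : Sig n m} {u v : Fin n →₀ ℕ} (h : u ≤ v) : Dvd (mul u a) (mul v a) :=
  ⟨rfl, by simpa [mul] using h⟩

/-- The degree of `t F_i` in the grading in which `F_i` has degree `D i`. -/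
noncomputable def wdeg (D : Fin m → ℕ) (a : Sig n m) : ℕ := a.mon.degree + D a.idx

theorem wdeg_mul (D : Fin m → ℕ) (u : Fin n →₀ ℕ) (a : Sig n m) :
    wdeg D (mul u a) = u.degree + wdeg D a := by
  simp [wdeg, mul, add_assoc]

end Sig

/-! ### Admissible polynomials, syzygies and normal forms. -/

section Module

variable {n m : ℕ} {K : Type*} [Field K] (mo : MonomialOrder (Fin n))
  (F : Fin m → MvPolynomial (Fin n) K)

/-- The polynomial `t f_i` of the signature `t F_i`. -/
noncomputable def gen (a : Sig n m) : MvPolynomial (Fin n) K := monomial a.mon 1 * F a.idx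

/-- The polynomials that are combinations of multiples `t f_i` with signature below `σ`. -/
noncomputable def below (σ : Sig n m) : Submodule K (MvPolynomial (Fin n) K) :=
  Submodule.span K {p | ∃ τ, Sig.Lt mo τ σ ∧ p = gen F τ}

/-- The signature of `r` is the head of a representation of its polynomial. -/
def Admissible (r : LabeledPoly n m K) : Prop :=
  ∃ c : K, c ≠ 0 ∧ r.poly - c • gen F r.sig ∈ below mo F r.sig

variable {mo F}

theorem gen_mul (u : Fin n →₀ ℕ) (a : Sig n m) : gen F (Sig.mul u a) = monomial u 1 * gen F a := by
  simp [gen, ← mul_assoc, monomial_mul]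

theorem gen_mem_below {τ σ : Sig n m} (h : Sig.Lt mo τ σ) : gen F τ ∈ below mo F σ :=
  Submodule.subset_span ⟨τ, h, rfl⟩

theorem below_mono {τ σ : Sig n m} (h : ¬ Sig.Lt mo σ τ) : below mo F τ ≤ below mo F σ :=
  Submodule.span_mono fun _ ⟨ρ, hρ, e⟩ => ⟨ρ, Sig.not_lt_of_lt_of_not_lt hρ h, e⟩

theorem monomial_mul_eq_smul (u : Fin n →₀ ℕ) (c : K) (p : MvPolynomial (Fin n) K) :
    monomial u c * p = c • (monomial u 1 * p) := by
  rw [← smul_mul_assoc, smul_monomial, smul_eq_mul, mul_one]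

theorem monomial_mul_mem_below {σ : Sig n m} {p : MvPolynomial (Fin n) K} (u : Fin n →₀ ℕ)
    (h : p ∈ below mo F σ) : monomial u 1 * p ∈ below mo F (Sig.mul u σ) := by
  induction h using Submodule.span_induction with
  | mem x hx =>
    obtain ⟨τ, hτ, rfl⟩ := hx
    rw [← gen_mul]
    exact gen_mem_below (hτ.mul u)
  | zero => simp
  | add x y _ _ hx hy => rw [mul_add]; exact add_mem hx hy
  | smul a x _ hx => rw [mul_smul_comm]; exact Submodule.smul_mem _ _ hx

theorem Admissible.monomial_mul_mem {r : LabeledPoly n m K} (h : Admissible mo F r)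
    {σ : Sig n m} (u : Fin n →₀ ℕ) (c : K) (hlt : Sig.Lt mo (Sig.mul u r.sig) σ) :
    monomial u c * r.poly ∈ below mo F σ := by
  obtain ⟨a, -, ha⟩ := h
  rw [monomial_mul_eq_smul]
  apply Submodule.smul_mem
  have h1 := below_mono hlt.asymm (monomial_mul_mem_below u ha)
  rw [mul_sub, mul_smul_comm, ← gen_mul] at h1
  have h2 := add_mem h1 (Submodule.smul_mem _ a (gen_mem_below hlt))
  rwa [sub_add_cancel] at h2

/-- A larger index makes a signature smaller whatever its monomial, so every term of `q` may be
treated separately. -/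
theorem Admissible.mul_mem {r : LabeledPoly n m K} (h : Admissible mo F r)
    {σ : Sig n m} (q : MvPolynomial (Fin n) K) (hlt : σ.idx < r.sig.idx) :
    q * r.poly ∈ below mo F σ := by
  rw [q.as_sum, Finset.sum_mul]
  exact Submodule.sum_mem _ fun x _ => h.monomial_mul_mem _ _ (Or.inl hlt)

/-- Adding an element of lower signature keeps a labeled polynomial admissible. -/
theorem Admissible.sub {r : LabeledPoly n m K} (h : Admissible mo F r)
    {p : MvPolynomial (Fin n) K} (hp : p ∈ below mo F r.sig) :
    Admissible mo F ⟨r.sig, r.poly - p⟩ := by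
  obtain ⟨c, hc, h⟩ := h
  refine ⟨c, hc, ?_⟩
  have := sub_mem h hp
  rwa [sub_right_comm] at this

theorem Admissible.mul {r : LabeledPoly n m K} (h : Admissible mo F r) (u : Fin n →₀ ℕ) :
    Admissible mo F ⟨Sig.mul u r.sig, monomial u 1 * r.poly⟩ := by
  obtain ⟨c, hc, h⟩ := h
  refine ⟨c, hc, ?_⟩
  have := monomial_mul_mem_below u h
  rwa [mul_sub, mul_smul_comm, ← gen_mul] at this

theorem Admissible.C_mul {r : LabeledPoly n m K} (h : Admissible mo F r) {a : K} (ha : a ≠ 0) :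
    Admissible mo F ⟨r.sig, C a * r.poly⟩ := by
  obtain ⟨c, hc, h⟩ := h
  refine ⟨a * c, mul_ne_zero ha hc, ?_⟩
  have := Submodule.smul_mem _ a h
  rwa [smul_sub, smul_smul, ← C_mul'] at this

/-- A signature whose monomial is a multiple of a head monomial of the ideal of the later inputs
is the head of a syzygy. -/
theorem gen_mem_below_of_head_le {τ : Sig n m} {r : LabeledPoly n m K} (h : Admissible mo F r)
    (h0 : r.poly ≠ 0) (hidx : τ.idx < r.sig.idx) (hle : mo.degree r.poly ≤ τ.mon) :
    gen F τ ∈ below mo F τ := by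
  obtain ⟨a, ha⟩ := exists_add_of_le hle
  -- The principal syzygy: this product is a multiple of `r`, hence lies below `τ`. Expanding `r`
  -- into monomials instead gives a multiple of `gen F τ` by the head coefficient, plus terms below
  -- `τ`.
  have h1 : monomial a 1 * F τ.idx * r.poly ∈ below mo F τ := h.mul_mem _ hidx
  have h2 : monomial a 1 * F τ.idx * r.poly =
      ∑ x ∈ r.poly.support, r.poly.coeff x • gen F ⟨a + x, τ.idx⟩ := by
    conv_lhs => rw [r.poly.as_sum, Finset.mul_sum]
    refine Finset.sum_congr rfl fun x _ => ?_
    rw [gen, ← monomial_mul_eq_smul, mul_right_comm, monomial_mul, one_mul]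
  have hd := mo.degree_mem_support h0
  rw [h2, ← Finset.add_sum_erase _ _ hd] at h1
  have h3 : ∑ x ∈ r.poly.support.erase (mo.degree r.poly),
      r.poly.coeff x • gen F ⟨a + x, τ.idx⟩ ∈ below mo F τ := by
    refine Submodule.sum_mem _ fun x hx => Submodule.smul_mem _ _ (gen_mem_below (Or.inr ⟨rfl, ?_⟩))
    rw [Finset.mem_erase] at hx
    have : mo.toSyn x < mo.toSyn (mo.degree r.poly) :=
      lt_of_le_of_ne (mo.le_degree hx.2) fun e => hx.1 (mo.toSyn.injective e)
    rw [ha, add_comm]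
    simpa using this
  have h4 := (Submodule.add_mem_iff_left _ h3).1 h1
  rw [Submodule.smul_mem_iff _ (MvPolynomial.mem_support_iff.1 hd), add_comm, ← ha] at h4
  exact h4

theorem degree_monomial_mul {p : MvPolynomial (Fin n) K} (hp : p ≠ 0) (u : Fin n →₀ ℕ) {c : K}
    (hc : c ≠ 0) : mo.degree (monomial u c * p) = u + mo.degree p := by
  classical
  rw [mo.degree_mul (by simpa using hc) hp, mo.degree_monomial, if_neg hc]

/-- The head monomial of an element of the span of polynomials with distinct head monomials is one
of these head monomials. -/
theorem exists_degree_eq_of_mem_span {T : Set (MvPolynomial (Fin n) K)} (h0 : ∀ t ∈ T, t ≠ 0)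
    (hinj : Set.InjOn mo.degree T) {p : MvPolynomial (Fin n) K} (hp : p ≠ 0)
    (hmem : p ∈ Submodule.span K T) : ∃ t ∈ T, mo.degree t = mo.degree p := by
  obtain ⟨c, hc, rfl⟩ := (Finsupp.mem_span_iff_linearCombination K T p).1 hmem |>.imp
    fun c hc => And.intro trivial hc.symm
  have hne : c.support.Nonempty := by
    rw [Finsupp.support_nonempty_iff]
    rintro rfl
    simp at hp
  -- The largest head monomial that occurs does so only once, so it cannot cancel.
  obtain ⟨t, ht, hmax⟩ := Finset.exists_max_image c.support
    (fun t : T => mo.toSyn (mo.degree t.1)) hne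
  refine ⟨t.1, t.2, ?_⟩
  rw [Finsupp.linearCombination_apply, Finsupp.sum]
  have hle : mo.toSyn (mo.degree (∑ x ∈ c.support, c x • x.1)) ≤ mo.toSyn (mo.degree t.1) := by
    refine mo.degree_sum_le.trans (Finset.sup_le fun x hx => ?_)
    exact mo.degree_smul_le.trans (hmax x hx)
  apply mo.toSyn.injective
  refine le_antisymm (mo.le_degree ?_) hle
  rw [MvPolynomial.mem_support_iff, coeff_sum, Finset.sum_eq_single t]
  · rw [coeff_smul]
    exact mul_ne_zero (Finsupp.mem_support_iff.1 ht) (mo.coeff_degree_ne_zero_iff.2 (h0 _ t.2))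
  · intro x hx hxt
    rw [coeff_smul, mo.coeff_eq_zero_of_lt, smul_zero]
    refine lt_of_le_of_ne (hmax x hx) fun e => hxt (Subtype.ext (hinj x.2 t.2 ?_))
    exact mo.toSyn.injective e
  · exact fun h => absurd ht h

theorem isHomogeneous_monomial_mul {p : MvPolynomial (Fin n) K} {d : ℕ} (hp : p.IsHomogeneous d)
    (u : Fin n →₀ ℕ) (c : K) : (monomial u c * p).IsHomogeneous (u.degree + d) :=
  (isHomogeneous_monomial c rfl).mul hp

theorem degree_degree {p : MvPolynomial (Fin n) K} {d : ℕ} (hp : p.IsHomogeneous d) (h0 : p ≠ 0) :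
    (mo.degree p).degree = d :=
  (hp.degree_eq_sum_deg_support (mo.degree_mem_support h0)).symm

/-- Reduction by elements of higher index keeps a homogeneous labeled polynomial homogeneous and
admissible. -/
theorem IsNormalForm.preserves {B : Set (MvPolynomial (Fin n) K)} {σ : Sig n m} {d : ℕ}
    (hB : ∀ b ∈ B, ∃ r : LabeledPoly n m K, r.poly = b ∧ Admissible mo F r ∧ σ.idx < r.sig.idx ∧
      ∃ e, b.IsHomogeneous e)
    {p q : MvPolynomial (Fin n) K} (h : IsNormalForm mo B p q)
    (hp : Admissible mo F ⟨σ, p⟩) (hd : p.IsHomogeneous d) :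
    Admissible mo F ⟨σ, q⟩ ∧ q.IsHomogeneous d := by
  obtain ⟨h, -⟩ := h
  induction h with
  | refl => exact ⟨hp, hd⟩
  | tail _ hstep ih =>
    obtain ⟨b, hb, hb0, a, ha, rfl⟩ := hstep
    obtain ⟨r, rfl, hr, hidx, e, he⟩ := hB b hb
    refine ⟨ih.1.sub (hr.mul_mem _ hidx), ih.2.sub ?_⟩
    -- The cancelled monomial lies in the support of a homogeneous polynomial of degree `d`.
    have h1 : d = a.degree + e := by
      rw [← degree_degree (mo := mo) he hb0, ← map_add]
      exact ih.2.degree_eq_sum_deg_support ha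
    rw [h1]
    exact isHomogeneous_monomial_mul he a _

theorem monic_ne_zero {p : MvPolynomial (Fin n) K} (hp : p ≠ 0) : monic mo p ≠ 0 :=
  mul_ne_zero (by simpa using hp) hp

theorem degree_monic {p : MvPolynomial (Fin n) K} (hp : p ≠ 0) :
    mo.degree (monic mo p) = mo.degree p := by
  rw [monic, ← monomial_zero', degree_monomial_mul hp _ (by simpa using hp), zero_add]

end Module

end F5

/-! ### The invariant and the two criteria. -/

namespace F5

open MvPolynomial

namespace State

variable {n m : ℕ} {K : Type*} [Field K] (mo : MonomialOrder (Fin n))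

/-- The multiple `u r_i` satisfies the F5 criterion or the Rewritten criterion. -/
def Superfluous (s : State n m K) (u : Fin n →₀ ℕ) (i : ℕ) : Prop :=
  s.SatisfiesF5 mo u i ∨ s.SatisfiesRewritten u i

/-- What holds for the critical pairs that wait to be processed. -/
structure Waiting (s : State n m K) (c : CritPair n) : Prop where
  mem₁ : c.pos₁ ∈ s.G s.call.val
  mem₂ : c.pos₂ ∈ s.G s.call.val
  ne : c.pos₁ ≠ c.pos₂
  idx₁ : (s.R c.pos₁).sig.idx = s.call
  lcm_eq : c.lcm = mo.degree (s.R c.pos₁).poly ⊔ mo.degree (s.R c.pos₂).poly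
  cof₁ : c.u₁ = s.cofactor mo c.pos₁ c.pos₂
  cof₂ : c.u₂ = s.cofactor mo c.pos₂ c.pos₁
  not_lt : ¬ Sig.Lt mo (Sig.mul c.u₁ (s.R c.pos₁).sig) (Sig.mul c.u₂ (s.R c.pos₂).sig)

/-- The pair of positions of `c` is `{a, b}`. -/
def _root_.F5.CritPair.Joins (c : CritPair n) (a b : ℕ) : Prop :=
  (c.pos₁ = a ∧ c.pos₂ = b) ∨ (c.pos₁ = b ∧ c.pos₂ = a)

/-- The invariant of the algorithm, for inputs `F i` that are homogeneous of degree `D i`. -/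
structure Invariant (F : Fin m → MvPolynomial (Fin n) K) (D : Fin m → ℕ) (s : State n m K) :
    Prop where
  m_le : m ≤ s.N
  input : ∀ k : Fin m, (s.R k.val).sig = ⟨0, k⟩ ∧ (s.R k.val).poly ≠ 0
  -- Hence at the start of a call its input is the only element of `R` with the index of the call.
  new_idx : ∀ j, m ≤ j → j < s.N → s.call ≤ (s.R j).sig.idx
  mem_G : ∀ i ∈ s.G s.call.val, i < s.N ∧ s.call ≤ (s.R i).sig.idx ∧ (s.R i).poly ≠ 0
  -- The sets `G k` are nested, so the elements that decide an F5 criterion are themselves basis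
  -- elements.
  mem_G_iff : ∀ k, s.call.val ≤ k → ∀ i,
    i ∈ s.G k ↔ i ∈ s.G s.call.val ∧ k ≤ (s.R i).sig.idx.val
  mem_ToDo : ∀ i ∈ s.ToDo,
    m ≤ i ∧ i < s.N ∧ (s.R i).sig.idx = s.call ∧ i ∉ s.G s.call.val ∧ i ∉ s.Done
  mem_Done : ∀ i ∈ s.Done,
    i < s.N ∧ (s.R i).sig.idx = s.call ∧ i ∉ s.G s.call.val ∧ (s.R i).poly ≠ 0
  cover : ∀ j < s.N, s.call ≤ (s.R j).sig.idx →
    j ∈ s.G s.call.val ∨ j ∈ s.Done ∨ j ∈ s.ToDo ∨ (s.R j).poly = 0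
  homogeneous : ∀ j < s.N, (s.R j).poly.IsHomogeneous (Sig.wdeg D (s.R j).sig)
  admissible : ∀ j < s.N, Admissible mo F (s.R j)
  waiting : ∀ c ∈ s.P ∪ s.Pd, s.Waiting mo c
  -- Superfluousness is permanent, so a pair may be forgotten once one of its parts is superfluous.
  pairs : ∀ a ∈ s.G s.call.val, ∀ b ∈ s.G s.call.val, a ≠ b →
    s.Superfluous mo (s.cofactor mo a b) a ∨ s.Superfluous mo (s.cofactor mo b a) b ∨
      ∃ c ∈ s.P ∪ s.Pd, c.Joins a b
  -- The substitute for `pairs` while an element is in `Done`: there the lcm is the head monomial of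
  -- `a`, so the cofactor of `a` is `0`.
  irreducible : ∀ a ∈ s.Done, ∀ b ∈ s.basis, a ≠ b →
    mo.degree (s.R b).poly ≤ mo.degree (s.R a).poly →
    s.Superfluous mo (mo.degree (s.R a).poly - mo.degree (s.R b).poly) b ∨ s.Superfluous mo 0 a
  degrees : ∃ d, s.phase = Phase.spol ∨ s.phase = Phase.reduction →
    (∀ c ∈ s.P, d < c.lcm.degree) ∧ (∀ c ∈ s.Pd, c.lcm.degree = d) ∧
    (∀ j ∈ s.ToDo, Sig.wdeg D (s.R j).sig = d) ∧ ∀ j ∈ s.Done, Sig.wdeg D (s.R j).sig = d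
  loop : s.phase = Phase.loop → s.Pd = ∅ ∧ s.ToDo = ∅ ∧ s.Done = ∅
  spol : s.phase = Phase.spol → s.Done = ∅
  reduction : s.phase = Phase.reduction → s.Pd = ∅
  update : s.phase = Phase.update → s.Pd = ∅ ∧ s.ToDo = ∅

variable {mo} {F : Fin m → MvPolynomial (Fin n) K} {D : Fin m → ℕ} {s s' : State n m K}

/-- A monomial is its own normal form exactly when it is irreducible, which turns the F5 criterion
into divisibility by a head monomial. -/
theorem not_fixedByNF_iff {k : ℕ} {u : Fin n →₀ ℕ} :
    ¬ s.FixedByNF mo k u ↔ ∃ i ∈ s.G k, (s.R i).poly ≠ 0 ∧ mo.degree (s.R i).poly ≤ u := by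
  classical
  constructor
  · intro h
    simp only [FixedByNF, IsNormalForm, Relation.ReflTransGen.refl, true_and, not_forall,
      not_not] at h
    obtain ⟨_, _, ⟨i, hi, rfl⟩, h0, a, ha, -⟩ := h
    refine ⟨i, hi, h0, ?_⟩
    rw [support_monomial, if_neg one_ne_zero, Finset.mem_singleton] at ha
    rw [← ha]
    simp
  · rintro ⟨i, hi, h0, hle⟩ ⟨-, h⟩
    refine h _ ⟨_, ⟨i, hi, rfl⟩, h0, u - mo.degree (s.R i).poly, ?_, rfl⟩
    rw [tsub_add_cancel_of_le hle, support_monomial, if_neg one_ne_zero, Finset.mem_singleton]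

/-- The F5 criterion looks only at a finished basis, and the Rewritten criterion gets easier to
satisfy as `R` grows. -/
theorem superfluous_mono {i : ℕ} {u : Fin n →₀ ℕ} (hi : i < s.N) (hN : s.N ≤ s'.N)
    (hsig : ∀ j < s.N, (s'.R j).sig = (s.R j).sig)
    (hG : s'.G ((s.R i).sig.idx.val + 1) = s.G ((s.R i).sig.idx.val + 1))
    (hpoly : ∀ j ∈ s.G ((s.R i).sig.idx.val + 1), (s'.R j).poly = (s.R j).poly)
    (h : s.Superfluous mo u i) : s'.Superfluous mo u i := by
  rcases h with h | ⟨j, hij, hj, hdvd⟩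
  · left
    rw [SatisfiesF5, not_fixedByNF_iff] at h ⊢
    rw [hsig i hi, hG]
    obtain ⟨j, hj, h0, hle⟩ := h
    exact ⟨j, hj, by rwa [hpoly j hj], by rwa [hpoly j hj]⟩
  · right
    exact ⟨j, hij, hj.trans_le hN, by rwa [hsig i hi, hsig j hj]⟩

/-- Passes from the cofactors at the lcm to an arbitrary common multiple of two head monomials. -/
theorem superfluous_of_dvd {i : ℕ} {u v : Fin n →₀ ℕ} (hle : u ≤ v) (h : s.Superfluous mo u i) :
    s.Superfluous mo v i := by
  rcases h with h | ⟨j, hij, hj, hdvd⟩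
  · left
    rw [SatisfiesF5, not_fixedByNF_iff] at h ⊢
    obtain ⟨j, hj, h0, h⟩ := h
    exact ⟨j, hj, h0, h.trans (Sig.mul_mono hle).2⟩
  · right
    exact ⟨j, hij, hj, hdvd.1, hdvd.2.trans (Sig.mul_mono hle).2⟩

/-- Of two multiples with the same signature the one of the older element is rewritten. -/
theorem rewritten_of_sig_eq {a b : ℕ} {u v : Fin n →₀ ℕ} (hab : a ≠ b) (ha : a < s.N)
    (hb : b < s.N) (h : Sig.mul u (s.R a).sig = Sig.mul v (s.R b).sig) :
    s.SatisfiesRewritten u a ∨ s.SatisfiesRewritten v b := by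
  rcases lt_or_gt_of_ne hab with hlt | hlt
  · refine Or.inl ⟨b, hlt, hb, ?_⟩
    rw [h]
    simpa using Sig.mul_mono (a := (s.R b).sig) (zero_le : 0 ≤ v)
  · refine Or.inr ⟨a, hlt, ha, ?_⟩
    rw [← h]
    simpa using Sig.mul_mono (a := (s.R a).sig) (zero_le : 0 ≤ u)

/-- The pair is formed in `s`, before the new element enters `G`, and waits in `s'`. -/
theorem critPair_waiting {r q : ℕ} {c : CritPair n} (hc : c ∈ s.critPair mo r q) (hne : r ≠ q)
    (hr : r ∈ s'.G s'.call.val) (hq : q ∈ s'.G s'.call.val) (hR : s'.R = s.R)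
    (hcall : s'.call = s.call) (hidxr : s.call ≤ (s.R r).sig.idx)
    (hidxq : s.call ≤ (s.R q).sig.idx) : s'.Waiting mo c := by
  obtain ⟨h, hidx, -, -⟩ := hc
  have hcof : ∀ a b, s'.cofactor mo a b = s.cofactor mo a b := fun a b => by
    simp only [cofactor, hR]
  unfold orderedPair at h
  split_ifs at h with hlt
  · subst h
    exact ⟨hq, hr, hne.symm, by rw [hR, hcall]; exact le_antisymm hidx hidxq,
      by rw [hR]; exact sup_comm _ _, (hcof _ _).symm, (hcof _ _).symm,
      by rw [hR]; exact hlt.asymm⟩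
  · subst h
    exact ⟨hr, hq, hne, by rw [hR, hcall]; exact le_antisymm hidx hidxr,
      by rw [hR], (hcof _ _).symm, (hcof _ _).symm, by rw [hR]; exact hlt⟩

/-- As `r` has the index of the call, the part of greater signature also has this index. So
`CritPair` can refuse the pair only because of the F5 criterion. -/
theorem critPair_cover {r q : ℕ} (hr : (s.R r).sig.idx = s.call)
    (hq : s.call ≤ (s.R q).sig.idx) :
    s.Superfluous mo (s.cofactor mo r q) r ∨ s.Superfluous mo (s.cofactor mo q r) q ∨
      ∃ c ∈ s.critPair mo r q, c.Joins r q := by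
  by_contra! H
  obtain ⟨h1, h2, h3⟩ := H
  have h1 : s.FixedByNF mo (s.call.val + 1)
      (Sig.mul (s.cofactor mo r q) (s.R r).sig).mon := by
    by_contra h
    exact h1 (Or.inl (by rw [SatisfiesF5, hr]; exact h))
  have h2 : (s.R q).sig.idx = s.call → s.FixedByNF mo (s.call.val + 1)
      (Sig.mul (s.cofactor mo q r) (s.R q).sig).mon := by
    intro hq
    by_contra h
    exact h2 (Or.inl (by rw [SatisfiesF5, hq]; exact h))
  have h4 : (s.orderedPair mo r q).Joins r q := by
    unfold orderedPair
    split_ifs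
    · exact Or.inr ⟨rfl, rfl⟩
    · exact Or.inl ⟨rfl, rfl⟩
  refine h3 _ ⟨rfl, ?_⟩ h4
  unfold orderedPair
  split_ifs with hlt
  · have : (s.R q).sig.idx = s.call := by
      have hle := Sig.idx_le_of_not_lt hlt.asymm
      rw [Sig.mul_idx, Sig.mul_idx] at hle
      exact le_antisymm (hle.trans hr.le) hq
    exact ⟨this.le, h2 this, fun _ => h1⟩
  · exact ⟨hr.le, h1, h2⟩

namespace Invariant

variable (I : Invariant mo F D s)

include I

theorem lt_of_mem_basis {i : ℕ} (hi : i ∈ s.basis) : i < s.N := by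
  rw [basis, Finset.mem_union] at hi
  exact hi.elim (fun h => (I.mem_G i h).1) fun h => (I.mem_Done i h).1

theorem idx_of_mem_basis {i : ℕ} (hi : i ∈ s.basis) : s.call ≤ (s.R i).sig.idx := by
  rw [basis, Finset.mem_union] at hi
  exact hi.elim (fun h => (I.mem_G i h).2.1) fun h => (I.mem_Done i h).2.1.ge

theorem poly_ne_zero {i : ℕ} (hi : i ∈ s.basis) : (s.R i).poly ≠ 0 := by
  rw [basis, Finset.mem_union] at hi
  exact hi.elim (fun h => (I.mem_G i h).2.2) fun h => (I.mem_Done i h).2.2.2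

theorem not_mem_basis {i : ℕ} (hi : i ∈ s.ToDo) : i ∉ s.basis := by
  rw [basis, Finset.mem_union, not_or]
  exact (I.mem_ToDo i hi).2.2.2

theorem subset_basis {k : ℕ} (hk : s.call.val ≤ k) {i : ℕ} (hi : i ∈ s.G k) : i ∈ s.basis :=
  Finset.mem_union_left _ ((I.mem_G_iff k hk i).1 hi).1

theorem mem_G_of_lt_idx {i : ℕ} (hi : i ∈ s.basis) (hlt : s.call < (s.R i).sig.idx) :
    i ∈ s.G s.call.val := by
  rw [basis, Finset.mem_union] at hi
  exact hi.resolve_right fun h => hlt.ne' (I.mem_Done i h).2.1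

/-- Superfluousness is kept by steps that change no element of the basis and append elements. -/
theorem superfluous_mono {i : ℕ} {u : Fin n →₀ ℕ} (hi : i < s.N)
    (hidx : s.call ≤ (s.R i).sig.idx) (hN : s.N ≤ s'.N)
    (hsig : ∀ j < s.N, (s'.R j).sig = (s.R j).sig)
    (hG : ∀ k, s.call.val < k → s'.G k = s.G k)
    (hpoly : ∀ j ∈ s.basis, (s'.R j).poly = (s.R j).poly)
    (h : s.Superfluous mo u i) : s'.Superfluous mo u i := by
  have hlt : s.call.val < (s.R i).sig.idx.val + 1 := Nat.lt_succ_of_le hidx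
  exact State.superfluous_mono hi hN hsig (hG _ hlt)
    (fun j hj => hpoly j (I.subset_basis hlt.le hj)) h

end Invariant

end State

end F5

/-! ### Elementary changes of the state preserve the invariant. -/

namespace F5

open MvPolynomial

namespace State

variable {n m : ℕ} {K : Type*} [Field K] {mo : MonomialOrder (Fin n)}
  {F : Fin m → MvPolynomial (Fin n) K} {D : Fin m → ℕ} {s s' : State n m K}

theorem setPoly_sig (h : ℕ) (p : MvPolynomial (Fin n) K) (j : ℕ) :
    ((s.setPoly h p).R j).sig = (s.R j).sig := by
  simp only [setPoly, Function.update_apply]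
  split_ifs with e
  · rw [e]
  · rfl

theorem setPoly_of_ne {h j : ℕ} (p : MvPolynomial (Fin n) K) (hj : j ≠ h) :
    (s.setPoly h p).R j = s.R j := by
  simp only [setPoly, Function.update_apply, if_neg hj]

theorem setPoly_self (h : ℕ) (p : MvPolynomial (Fin n) K) :
    (s.setPoly h p).R h = ⟨(s.R h).sig, p⟩ := by
  simp only [setPoly, Function.update_self]

theorem append_of_ne (r : LabeledPoly n m K) {j : ℕ} (hj : j ≠ s.N) :
    (s.append r).R j = s.R j := by
  simp only [append, Function.update_apply, if_neg hj]

theorem append_self (r : LabeledPoly n m K) : (s.append r).R s.N = r := by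
  simp only [append, Function.update_self]

theorem Waiting.congr {c : CritPair n} (h : s.Waiting mo c) (hcall : s'.call = s.call)
    (hG : s.G s.call.val ⊆ s'.G s.call.val)
    (hR : ∀ j ∈ s.G s.call.val, s'.R j = s.R j) : s'.Waiting mo c := by
  have h1 := hR _ h.mem₁
  have h2 := hR _ h.mem₂
  exact ⟨hcall ▸ hG h.mem₁, hcall ▸ hG h.mem₂, h.ne, by rw [h1, hcall, h.idx₁],
    by rw [h1, h2, h.lcm_eq], by rw [cofactor, h1, h2]; exact h.cof₁,
    by rw [cofactor, h1, h2]; exact h.cof₂, by rw [h1, h2]; exact h.not_lt⟩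

namespace Invariant

variable (I : Invariant mo F D s)

include I

/-- Elements of `ToDo` are outside the basis, so neither the criteria nor the pairs see their
polynomials. -/
theorem setPoly {h : ℕ} (hh : h ∈ s.ToDo) {p : MvPolynomial (Fin n) K}
    (ha : Admissible mo F ⟨(s.R h).sig, p⟩) (hp : p.IsHomogeneous (Sig.wdeg D (s.R h).sig)) :
    Invariant mo F D (s.setPoly h p) := by
  have hR : ∀ j ∈ s.basis, (s.setPoly h p).R j = s.R j := fun j hj =>
    setPoly_of_ne p (by rintro rfl; exact I.not_mem_basis hh hj)
  have hRG : ∀ j ∈ s.G s.call.val, (s.setPoly h p).R j = s.R j := fun j hj =>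
    hR j (Finset.mem_union_left _ hj)
  have hRD : ∀ j ∈ s.Done, (s.setPoly h p).R j = s.R j := fun j hj =>
    hR j (Finset.mem_union_right _ hj)
  have hS : ∀ u, ∀ i ∈ s.basis, s.Superfluous mo u i → (s.setPoly h p).Superfluous mo u i :=
    fun u i hi => I.superfluous_mono (I.lt_of_mem_basis hi) (I.idx_of_mem_basis hi) le_rfl
      (fun j _ => setPoly_sig h p j) (fun _ _ => rfl) (fun j hj => by rw [hR j hj])
  have hcof : ∀ a ∈ s.G s.call.val, ∀ b ∈ s.G s.call.val,
      (s.setPoly h p).cofactor mo a b = s.cofactor mo a b := fun a ha b hb => by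
    rw [cofactor, cofactor, hRG a ha, hRG b hb]
  refine { I with
    input := fun k => ?_
    new_idx := fun j hj hjN => ?_
    mem_G := fun i hi => ?_
    mem_G_iff := fun k hk i => ?_
    mem_ToDo := fun i hi => ?_
    mem_Done := fun i hi => ?_
    cover := fun j hj hidx => ?_
    homogeneous := fun j hj => ?_
    admissible := fun j hj => ?_
    waiting := fun c hc => (I.waiting c hc).congr rfl (fun _ h => h) hRG
    pairs := fun a ha b hb hab => ?_
    irreducible := fun a ha b hb hab hle => ?_
    degrees := ?_ }
  · rw [setPoly_of_ne]
    · exact I.input k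
    · have := (I.mem_ToDo h hh).1
      have := k.2
      omega
  · rw [setPoly_sig]
    exact I.new_idx j hj hjN
  · rw [hRG i hi]
    exact I.mem_G i hi
  · rw [setPoly_sig]
    exact I.mem_G_iff k hk i
  · rw [setPoly_sig]
    exact I.mem_ToDo i hi
  · rw [hRD i hi]
    exact I.mem_Done i hi
  · by_cases e : j = h
    · exact Or.inr (Or.inr (Or.inl (e ▸ hh)))
    · rw [setPoly_of_ne p e] at hidx ⊢
      exact I.cover j hj hidx
  · by_cases e : j = h
    · rw [e, setPoly_self]
      exact hp
    · rw [setPoly_of_ne p e]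
      exact I.homogeneous j hj
  · by_cases e : j = h
    · rw [e, setPoly_self]
      exact ha
    · rw [setPoly_of_ne p e]
      exact I.admissible j hj
  · rw [hcof a ha b hb, hcof b hb a ha]
    exact (I.pairs a ha b hb hab).imp (hS _ a (Finset.mem_union_left _ ha))
      (Or.imp_left (hS _ b (Finset.mem_union_left _ hb)))
  · rw [hRD a ha, hR b hb] at *
    exact (I.irreducible a ha b hb hab hle).imp (hS _ b hb)
      (hS _ a (Finset.mem_union_right _ ha))
  · simp only [setPoly_sig]
    exact I.degrees

/-- The new element goes to `ToDo`, so the basis is unchanged. `hd` says that its degree is the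
current one. -/
theorem append {r : LabeledPoly n m K} (hidx : r.sig.idx = s.call) (ha : Admissible mo F r)
    (hp : r.poly.IsHomogeneous (Sig.wdeg D r.sig))
    (hphase : s.phase = Phase.spol ∨ s.phase = Phase.reduction)
    (hd : (∃ c ∈ s.Pd, c.lcm.degree = Sig.wdeg D r.sig) ∨
      ∃ h ∈ s.ToDo, Sig.wdeg D (s.R h).sig = Sig.wdeg D r.sig) :
    Invariant mo F D (s.append r) := by
  have hlt : ∀ j < s.N, (s.append r).R j = s.R j := fun j hj => append_of_ne r hj.ne
  have hR : ∀ j ∈ s.basis, (s.append r).R j = s.R j := fun j hj => hlt j (I.lt_of_mem_basis hj)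
  have hRG : ∀ j ∈ s.G s.call.val, (s.append r).R j = s.R j := fun j hj =>
    hR j (Finset.mem_union_left _ hj)
  have hRD : ∀ j ∈ s.Done, (s.append r).R j = s.R j := fun j hj =>
    hR j (Finset.mem_union_right _ hj)
  have hS : ∀ u, ∀ i ∈ s.basis, s.Superfluous mo u i → (s.append r).Superfluous mo u i :=
    fun u i hi => I.superfluous_mono (I.lt_of_mem_basis hi) (I.idx_of_mem_basis hi)
      (Nat.le_succ _) (fun j hj => by rw [hlt j hj]) (fun _ _ => rfl)
      (fun j hj => by rw [hR j hj])
  have hcof : ∀ a ∈ s.G s.call.val, ∀ b ∈ s.G s.call.val,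
      (s.append r).cofactor mo a b = s.cofactor mo a b := fun a ha b hb => by
    rw [cofactor, cofactor, hRG a ha, hRG b hb]
  have hNG : s.N ∉ s.G s.call.val := fun h => (I.mem_G _ h).1.ne rfl
  have hND : s.N ∉ s.Done := fun h => (I.mem_Done _ h).1.ne rfl
  have hsucc : ∀ {j}, j < s.N + 1 → j = s.N ∨ j < s.N := fun h =>
    (Nat.lt_succ_iff_lt_or_eq.1 h).symm
  refine { I with
    m_le := I.m_le.trans (Nat.le_succ _)
    input := fun k => ?_
    new_idx := fun j hj hjN => ?_
    mem_G := fun i hi => ?_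
    mem_G_iff := fun k hk i => ?_
    mem_ToDo := fun i hi => ?_
    mem_Done := fun i hi => ?_
    cover := fun j hj hidx => ?_
    homogeneous := fun j hj => ?_
    admissible := fun j hj => ?_
    waiting := fun c hc => (I.waiting c hc).congr rfl (fun _ h => h) hRG
    pairs := fun a ha b hb hab => ?_
    irreducible := fun a ha b hb hab hle => ?_
    degrees := ?_
    loop := ?_
    update := ?_ }
  · rw [hlt _ (k.2.trans_le I.m_le)]
    exact I.input k
  · rcases hsucc hjN with rfl | h
    · rw [append_self, hidx]
      rfl
    · rw [hlt j h]
      exact I.new_idx j hj h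
  · rw [hRG i hi]
    exact (I.mem_G i hi).imp_left fun h => h.trans (Nat.lt_succ_self _)
  · rcases eq_or_ne i s.N with rfl | h
    · have := I.mem_G_iff k hk s.N
      simp only [hNG, false_and, iff_false] at this
      exact iff_of_false this fun h => hNG h.1
    · rw [append_of_ne r h]
      exact I.mem_G_iff k hk i
  · rcases Finset.mem_insert.1 hi with rfl | h
    · rw [append_self]
      exact ⟨I.m_le, Nat.lt_succ_self _, hidx, hNG, hND⟩
    · have := I.mem_ToDo i h
      rw [hlt i this.2.1]
      exact this.imp_right (And.imp_left fun h => h.trans (Nat.lt_succ_self _))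
  · rw [hRD i hi]
    exact (I.mem_Done i hi).imp_left fun h => h.trans (Nat.lt_succ_self _)
  · rcases hsucc hj with rfl | h
    · exact Or.inr (Or.inr (Or.inl (Finset.mem_insert_self _ _)))
    · rw [hlt j h] at hidx ⊢
      exact (I.cover j h hidx).imp_right (Or.imp_right (Or.imp_left Finset.mem_insert_of_mem))
  · rcases hsucc hj with rfl | h
    · rw [append_self]
      exact hp
    · rw [hlt j h]
      exact I.homogeneous j h
  · rcases hsucc hj with rfl | h
    · rw [append_self]
      exact ha
    · rw [hlt j h]
      exact I.admissible j h
  · rw [hcof a ha b hb, hcof b hb a ha]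
    exact (I.pairs a ha b hb hab).imp (hS _ a (Finset.mem_union_left _ ha))
      (Or.imp_left (hS _ b (Finset.mem_union_left _ hb)))
  · rw [hRD a ha, hR b hb] at *
    exact (I.irreducible a ha b hb hab hle).imp (hS _ b hb)
      (hS _ a (Finset.mem_union_right _ ha))
  · obtain ⟨d, h⟩ := I.degrees
    refine ⟨d, fun _ => ?_⟩
    obtain ⟨h1, h2, h3, h4⟩ := h hphase
    refine ⟨h1, h2, fun j hj => ?_, fun j hj => by rw [hRD j hj]; exact h4 j hj⟩
    rcases Finset.mem_insert.1 hj with rfl | hj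
    · rw [append_self]
      rcases hd with ⟨c, hc, e⟩ | ⟨h, hh, e⟩
      · rw [← e, h2 c hc]
      · rw [← e, h3 h hh]
    · rw [hlt j (I.mem_ToDo j hj).2.1]
      exact h3 j hj
  · intro h
    change s.phase = _ at h
    simp [h] at hphase
  · intro h
    change s.phase = _ at h
    simp [h] at hphase

theorem drop {h : ℕ} (h0 : (s.R h).poly = 0) (hphase : s.phase = Phase.reduction) :
    Invariant mo F D { s with ToDo := s.ToDo.erase h } :=
  { I with
    mem_ToDo := fun i hi => I.mem_ToDo i (Finset.mem_of_mem_erase hi)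
    cover := fun j hj hidx => by
      rcases eq_or_ne j h with rfl | hne
      · exact Or.inr (Or.inr (Or.inr h0))
      · exact (I.cover j hj hidx).imp_right
          (Or.imp_right (Or.imp_left fun hj => Finset.mem_erase.2 ⟨hne, hj⟩))
    waiting := fun c hc => (I.waiting c hc).congr rfl (fun _ h => h) fun _ _ => rfl
    degrees := by
      obtain ⟨d, hd⟩ := I.degrees
      refine ⟨d, fun hp => ?_⟩
      obtain ⟨h1, h2, h3, h4⟩ := hd hp
      exact ⟨h1, h2, fun j hj => h3 j (Finset.mem_of_mem_erase hj), h4⟩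
    loop := fun hp => by
      change s.phase = _ at hp
      simp [hphase] at hp
    update := fun hp => by
      change s.phase = _ at hp
      simp [hphase] at hp }

/-- For the steps that only change the phase or move pairs between `P` and `Pd`. -/
theorem schedule {ph : Phase} {P Pd : Set (CritPair n)} (hP : P ∪ Pd = s.P ∪ s.Pd)
    (hdeg : ph = Phase.spol ∨ ph = Phase.reduction → ∃ d, (∀ c ∈ P, d < c.lcm.degree) ∧
      (∀ c ∈ Pd, c.lcm.degree = d) ∧ (∀ j ∈ s.ToDo, Sig.wdeg D (s.R j).sig = d) ∧
      ∀ j ∈ s.Done, Sig.wdeg D (s.R j).sig = d)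
    (hloop : ph = Phase.loop → Pd = ∅ ∧ s.ToDo = ∅ ∧ s.Done = ∅)
    (hspol : ph = Phase.spol → s.Done = ∅)
    (hreduction : ph = Phase.reduction → Pd = ∅)
    (hupdate : ph = Phase.update → Pd = ∅ ∧ s.ToDo = ∅) :
    Invariant mo F D { s with phase := ph, P := P, Pd := Pd } :=
  { I with
    waiting := fun c hc => (I.waiting c (hP ▸ hc)).congr rfl (fun _ h => h) fun _ _ => rfl
    pairs := fun a ha b hb hab => by
      change _ ∨ _ ∨ ∃ c ∈ P ∪ Pd, _
      rw [hP]
      exact I.pairs a ha b hb hab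
    degrees := by
      by_cases h : ph = Phase.spol ∨ ph = Phase.reduction
      · obtain ⟨d, hd⟩ := hdeg h
        exact ⟨d, fun _ => hd⟩
      · exact ⟨0, fun h' => absurd h' h⟩
    loop := hloop
    spol := hspol
    reduction := hreduction
    update := hupdate }

theorem removePair {c : CritPair n} (hc : c ∈ s.Pd) (hphase : s.phase = Phase.spol)
    (h : s.SatisfiesRewritten c.u₁ c.pos₁ ∨ s.SatisfiesRewritten c.u₂ c.pos₂) :
    Invariant mo F D { s with Pd := s.Pd \ {c} } :=
  { I with
    waiting := fun x hx => (I.waiting x (hx.imp_right fun h => h.1)).congr rfl (fun _ h => h)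
      fun _ _ => rfl
    pairs := fun a ha b hb hab => by
      have hw := I.waiting c (Or.inr hc)
      rw [hw.cof₁, hw.cof₂] at h
      rcases I.pairs a ha b hb hab with h1 | h1 | ⟨x, hx, hj⟩
      · exact Or.inl h1
      · exact Or.inr (Or.inl h1)
      · rcases eq_or_ne x c with rfl | hne
        · rcases hj with ⟨rfl, rfl⟩ | ⟨rfl, rfl⟩
          · exact h.elim (fun h => Or.inl (Or.inr h)) fun h => Or.inr (Or.inl (Or.inr h))
          · exact h.elim (fun h => Or.inr (Or.inl (Or.inr h))) fun h => Or.inl (Or.inr h)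
        · exact Or.inr (Or.inr ⟨x, hx.imp_right fun h => ⟨h, hne⟩, hj⟩)
    degrees := by
      obtain ⟨d, hd⟩ := I.degrees
      refine ⟨d, fun hp => ?_⟩
      obtain ⟨h1, h2, h3⟩ := hd hp
      exact ⟨h1, fun x hx => h2 x hx.1, h3⟩
    loop := fun hp => by
      change s.phase = _ at hp
      simp [hphase] at hp
    reduction := fun hp => by
      change s.phase = _ at hp
      simp [hphase] at hp
    update := fun hp => by
      change s.phase = _ at hp
      simp [hphase] at hp }

/-- `hirr` covers the pairs of `r_h` with older basis elements in which the head monomial of the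
latter is the divisor. -/
theorem finish {h : ℕ} (hh : h ∈ s.ToDo) (h0 : (s.R h).poly ≠ 0)
    (hphase : s.phase = Phase.reduction)
    (hirr : ∀ b ∈ s.basis, mo.degree (s.R b).poly ≤ mo.degree (s.R h).poly →
      s.Superfluous mo (mo.degree (s.R h).poly - mo.degree (s.R b).poly) b ∨
        s.Superfluous mo 0 h) :
    Invariant mo F D { s with ToDo := s.ToDo.erase h, Done := insert h s.Done } := by
  obtain ⟨d, hd⟩ := I.degrees
  obtain ⟨hd1, hd2, hd3, hd4⟩ := hd (Or.inr hphase)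
  have hT := I.mem_ToDo h hh
  exact { I with
    mem_ToDo := fun i hi => by
      rw [Finset.mem_erase] at hi
      have := I.mem_ToDo i hi.2
      refine ⟨this.1, this.2.1, this.2.2.1, this.2.2.2.1, fun h => ?_⟩
      exact (Finset.mem_insert.1 h).elim hi.1 this.2.2.2.2
    mem_Done := fun i hi => by
      rcases Finset.mem_insert.1 hi with rfl | hi
      · exact ⟨hT.2.1, hT.2.2.1, hT.2.2.2.1, h0⟩
      · exact I.mem_Done i hi
    cover := fun j hj hidx => by
      rcases eq_or_ne j h with rfl | hne
      · exact Or.inr (Or.inl (Finset.mem_insert_self _ _))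
      · exact (I.cover j hj hidx).imp_right (Or.imp Finset.mem_insert_of_mem
          (Or.imp_left fun hj => Finset.mem_erase.2 ⟨hne, hj⟩))
    waiting := fun c hc => (I.waiting c hc).congr rfl (fun _ h => h) fun _ _ => rfl
    irreducible := fun a ha b hb hab hle => by
      have hb : b = h ∨ b ∈ s.basis := by
        simp only [basis, Finset.mem_union, Finset.mem_insert] at hb ⊢
        tauto
      rcases Finset.mem_insert.1 ha with rfl | ha'
      · exact hirr b (hb.resolve_left hab.symm) hle
      · rcases hb with rfl | hb
        -- If the head monomial of the new element divides that of an element of `Done`, the two are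
        -- equal because both have degree `d`. So `hirr` applies with the roles exchanged.
        · have e : mo.degree (s.R b).poly = mo.degree (s.R a).poly := by
            have e1 := degree_degree (mo := mo) (I.homogeneous b hT.2.1) h0
            have e2 := degree_degree (mo := mo) (I.homogeneous a (I.mem_Done a ha').1)
              (I.mem_Done a ha').2.2.2
            rw [hd3 b hh] at e1
            rw [hd4 a ha'] at e2
            obtain ⟨x, hx⟩ := exists_add_of_le hle
            rw [hx, map_add, e1] at e2
            have : x = 0 := (Finsupp.degree_eq_zero_iff x).1 (by omega)
            rw [hx, this, add_zero]
          have := hirr a (Finset.mem_union_right _ ha') e.ge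
          change s.Superfluous mo (mo.degree (s.R a).poly - mo.degree (s.R b).poly) b ∨
            s.Superfluous mo 0 a
          rw [e, tsub_self] at this ⊢
          exact this.symm
        · exact I.irreducible a ha' b hb hab hle
    degrees := ⟨d, fun _ => ⟨hd1, hd2, fun j hj => hd3 j (Finset.mem_of_mem_erase hj),
      fun j hj => by
        rcases Finset.mem_insert.1 hj with rfl | hj
        · exact hd3 j hh
        · exact hd4 j hj⟩⟩
    loop := fun hp => by
      change s.phase = _ at hp
      simp [hphase] at hp
    spol := fun hp => by
      change s.phase = _ at hp
      simp [hphase] at hp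
    update := fun hp => by
      change s.phase = _ at hp
      simp [hphase] at hp }

theorem enlarge {r : ℕ} (hphase : s.phase = Phase.update) (hr : r ∈ s.Done) :
    Invariant mo F D { s with
      P := s.P ∪ ⋃ q ∈ s.G s.call.val, s.critPair mo r q
      G := Function.update s.G s.call.val (insert r (s.G s.call.val))
      Done := s.Done.erase r } := by
  set s' : State n m K := { s with
      P := s.P ∪ ⋃ q ∈ s.G s.call.val, s.critPair mo r q
      G := Function.update s.G s.call.val (insert r (s.G s.call.val))
      Done := s.Done.erase r } with hs'
  have hrD := I.mem_Done r hr
  have hG : s'.G s.call.val = insert r (s.G s.call.val) := Function.update_self ..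
  have hGne : ∀ k, k ≠ s.call.val → s'.G k = s.G k := fun k hk => Function.update_of_ne hk ..
  -- The element only moves from `Done` to `G`. The sets `G k` of finished calls do not change,
  -- which keeps the criteria.
  have hbasis : s'.basis = s.basis := by
    ext j
    rw [basis, basis, Finset.mem_union, Finset.mem_union]
    change j ∈ s'.G s.call.val ∨ j ∈ s.Done.erase r ↔ _
    rw [hG, Finset.mem_insert, Finset.mem_erase]
    rcases eq_or_ne j r with rfl | hne
    · simp [hr]
    · simp [hne]
  have hS : ∀ u, ∀ i ∈ s.basis, s.Superfluous mo u i → s'.Superfluous mo u i :=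
    fun u i hi => I.superfluous_mono (I.lt_of_mem_basis hi) (I.idx_of_mem_basis hi)
      le_rfl (fun j hj => rfl) (fun k hk => hGne k hk.ne') (fun j hj => rfl)
  have hSG := fun u i hi => hS u i (Finset.mem_union_left _ hi)
  have hP : s'.P ∪ s'.Pd = (s.P ∪ s.Pd) ∪ ⋃ q ∈ s.G s.call.val, s.critPair mo r q :=
    Set.union_right_comm ..
  exact { I with
    mem_G := fun i hi => by
      change i ∈ s'.G s.call.val at hi
      rw [hG, Finset.mem_insert] at hi
      rcases hi with rfl | hi
      · exact ⟨hrD.1, hrD.2.1.ge, hrD.2.2.2⟩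
      · exact I.mem_G i hi
    mem_G_iff := fun k hk i => by
      change i ∈ s'.G k ↔ i ∈ s'.G s.call.val ∧ _
      rcases eq_or_ne k s.call.val with rfl | hne
      · refine (and_iff_left_of_imp fun hi => ?_).symm
        rw [hG, Finset.mem_insert] at hi
        rcases hi with rfl | hi
        · exact hrD.2.1.ge
        · exact (I.mem_G i hi).2.1
      · rw [hGne k hne, hG, I.mem_G_iff k hk i, Finset.mem_insert]
        refine and_congr_left fun hki => ⟨Or.inr, fun h => h.resolve_left ?_⟩
        rintro rfl
        change k ≤ (s.R i).sig.idx.val at hki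
        rw [hrD.2.1] at hki
        exact hne (le_antisymm hki hk)
    mem_ToDo := fun i hi => by
      change i ∈ s.ToDo at hi
      simp [(I.update hphase).2] at hi
    mem_Done := fun i hi => by
      obtain ⟨hne, hi⟩ := Finset.mem_erase.1 hi
      have := I.mem_Done i hi
      refine ⟨this.1, this.2.1, fun h => ?_, this.2.2.2⟩
      change i ∈ s'.G s.call.val at h
      rw [hG, Finset.mem_insert] at h
      exact h.elim hne this.2.2.1
    cover := fun j hj hidx => by
      change j ∈ s'.G s.call.val ∨ j ∈ s.Done.erase r ∨ _
      rw [hG, Finset.mem_insert, Finset.mem_erase]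
      rcases eq_or_ne j r with rfl | hne
      · exact Or.inl (Or.inl rfl)
      · exact (I.cover j hj hidx).imp Or.inr (Or.imp_left fun h => ⟨hne, h⟩)
    waiting := fun c hc => by
      rw [hP] at hc
      have hsub : s.G s.call.val ⊆ s'.G s.call.val := by
        rw [hG]
        exact Finset.subset_insert _ _
      rcases hc with hc | hc
      · exact (I.waiting c hc).congr rfl hsub fun _ _ => rfl
      · simp only [Set.mem_iUnion] at hc
        obtain ⟨q, hq, hc⟩ := hc
        refine critPair_waiting hc ?_ ?_ (hsub hq) rfl rfl hrD.2.1.ge (I.mem_G q hq).2.1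
        · rintro rfl
          exact hrD.2.2.1 hq
        · change r ∈ s'.G s.call.val
          rw [hG]
          exact Finset.mem_insert_self _ _
    pairs := fun a ha b hb hab => by
      change a ∈ s'.G s.call.val at ha
      change b ∈ s'.G s.call.val at hb
      rw [hG, Finset.mem_insert] at ha hb
      rw [hP]
      have key : ∀ q ∈ s.G s.call.val, s'.Superfluous mo (s.cofactor mo r q) r ∨
          s'.Superfluous mo (s.cofactor mo q r) q ∨
          ∃ c ∈ (s.P ∪ s.Pd) ∪ ⋃ q ∈ s.G s.call.val, s.critPair mo r q, c.Joins r q := by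
        intro q hq
        refine (critPair_cover hrD.2.1 (I.mem_G q hq).2.1).imp
          (hS _ r (Finset.mem_union_right _ hr)) (Or.imp (hSG _ q hq) ?_)
        rintro ⟨c, hc, hj⟩
        exact ⟨c, Or.inr (Set.mem_biUnion (x := q) hq hc), hj⟩
      rcases ha with rfl | ha
      · exact key b (hb.resolve_left hab.symm)
      · rcases hb with rfl | hb
        · rcases key a ha with h | h | ⟨c, hc, hj⟩
          · exact Or.inr (Or.inl h)
          · exact Or.inl h
          · exact Or.inr (Or.inr ⟨c, hc, hj.symm⟩)
        · refine (I.pairs a ha b hb hab).imp (hSG _ a ha) (Or.imp (hSG _ b hb) ?_)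
          rintro ⟨c, hc, hj⟩
          exact ⟨c, Or.inl hc, hj⟩
    irreducible := fun a ha b hb hab hle => by
      rw [hbasis] at hb
      have ha := (Finset.mem_erase.1 ha).2
      exact (I.irreducible a ha b hb hab hle).imp (hS _ b hb)
        (hS _ a (Finset.mem_union_right _ ha))
    -- No degree is prescribed in phase `update`, so `0` is arbitrary.
    degrees := ⟨0, fun h => by
      change s.phase = _ ∨ s.phase = _ at h
      simp [hphase] at h⟩
    loop := fun hp => by
      change s.phase = _ at hp
      simp [hphase] at hp
    spol := fun hp => by
      change s.phase = _ at hp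
      simp [hphase] at hp }

end Invariant

end State

end F5

/-! ### The calls and steps of the algorithm preserve the invariant. -/

namespace F5

open MvPolynomial

variable {n m : ℕ} {K : Type*} [Field K] {mo : MonomialOrder (Fin n)}
  {F : Fin m → MvPolynomial (Fin n) K} {D : Fin m → ℕ}

/-- S-polynomials of admissible labeled polynomials with distinct signatures are admissible. -/
theorem Admissible.spoly {r t : LabeledPoly n m K} (hr : Admissible mo F r)
    (ht : Admissible mo F t) {u v : Fin n →₀ ℕ} (c : K)
    (hlt : Sig.Lt mo (Sig.mul v t.sig) (Sig.mul u r.sig)) :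
    Admissible mo F ⟨Sig.mul u r.sig, monomial u 1 * r.poly - monomial v c * t.poly⟩ :=
  (hr.mul u).sub (ht.monomial_mul_mem v c hlt)

theorem isHomogeneous_spoly {r t : LabeledPoly n m K}
    (hr : r.poly.IsHomogeneous (Sig.wdeg D r.sig)) (ht : t.poly.IsHomogeneous (Sig.wdeg D t.sig))
    (hr0 : r.poly ≠ 0) (ht0 : t.poly ≠ 0) {u v : Fin n →₀ ℕ} (c : K)
    (h : u + mo.degree r.poly = v + mo.degree t.poly) :
    (monomial u 1 * r.poly - monomial v c * t.poly).IsHomogeneous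
      (Sig.wdeg D (Sig.mul u r.sig)) := by
  have h1 := isHomogeneous_monomial_mul hr u 1
  have h2 := isHomogeneous_monomial_mul ht v c
  have h3 := congrArg Finsupp.degree h
  rw [map_add, map_add, degree_degree hr hr0, degree_degree ht ht0] at h3
  rw [Sig.wdeg_mul]
  rw [← h3] at h2
  exact h1.sub h2

namespace State

variable {s s' : State n m K}

/-- What holds before call `k`, as far as it matters for this call and the later ones. -/
structure BeforeCall (mo : MonomialOrder (Fin n)) (F : Fin m → MvPolynomial (Fin n) K)
    (D : Fin m → ℕ) (s : State n m K) (k : Fin m) : Prop where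
  m_le : m ≤ s.N
  input : ∀ k : Fin m, (s.R k.val).sig = ⟨0, k⟩ ∧ (s.R k.val).poly ≠ 0
  new_idx : ∀ j, m ≤ j → j < s.N → k < (s.R j).sig.idx
  mem_G : ∀ i ∈ s.G (k.val + 1), i < s.N ∧ k < (s.R i).sig.idx ∧ (s.R i).poly ≠ 0
  mem_G_iff : ∀ l, k.val < l → ∀ i, i ∈ s.G l ↔ i ∈ s.G (k.val + 1) ∧ l ≤ (s.R i).sig.idx.val
  cover : ∀ j < s.N, k < (s.R j).sig.idx → j ∈ s.G (k.val + 1) ∨ (s.R j).poly = 0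
  homogeneous : ∀ j < s.N, (s.R j).poly.IsHomogeneous (Sig.wdeg D (s.R j).sig)
  admissible : ∀ j < s.N, Admissible mo F (s.R j)
  pairs : ∀ a ∈ s.G (k.val + 1), ∀ b ∈ s.G (k.val + 1), a ≠ b →
    s.Superfluous mo (s.cofactor mo a b) a ∨ s.Superfluous mo (s.cofactor mo b a) b

theorem BeforeCall.enterCall {k : Fin m} (B : BeforeCall mo F D s k) :
    Invariant mo F D (s.enterCall mo k) := by
  set s' := s.enterCall mo k with hs'
  have hG : s'.G k.val = insert k.val (s.G (k.val + 1)) := Function.update_self ..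
  have hGne : ∀ l, l ≠ k.val → s'.G l = s.G l := fun l hl => Function.update_of_ne hl ..
  have hk := B.input k
  have hkidx : (s.R k.val).sig.idx = k := by rw [hk.1]
  have hkN : k.val < s.N := k.2.trans_le B.m_le
  have hkG : k.val ∉ s.G (k.val + 1) := fun h => (B.mem_G _ h).2.1.ne' hkidx
  -- Needed for `t = s` and for `s` with the new call number, in which the pairs are formed.
  -- Elements of index at least `k` are tested against `G l` with `l > k`, so the change of `G k` is
  -- harmless.
  have hS : ∀ {t : State n m K}, t.R = s.R → t.N = s.N → (∀ l, l ≠ k.val → t.G l = s.G l) →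
      ∀ u, ∀ i ∈ insert k.val (s.G (k.val + 1)), t.Superfluous mo u i →
      s'.Superfluous mo u i := by
    intro t htR htN htG u i hi
    have h1 : i < s.N ∧ k ≤ (s.R i).sig.idx := by
      rcases Finset.mem_insert.1 hi with rfl | hi
      · exact ⟨hkN, hkidx.ge⟩
      · exact ⟨(B.mem_G i hi).1, (B.mem_G i hi).2.1.le⟩
    have h2 : (t.R i).sig.idx.val + 1 ≠ k.val := by
      rw [htR]
      have : k.val ≤ (s.R i).sig.idx.val := h1.2
      omega
    refine superfluous_mono (by rw [htN]; exact h1.1) htN.le (fun j _ => by rw [htR]; rfl) ?_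
      (fun j _ => by rw [htR]; rfl)
    rw [htG _ h2, hGne _ h2]
  exact {
    m_le := B.m_le
    input := B.input
    new_idx := fun j hj hjN => (B.new_idx j hj hjN).le
    mem_G := fun i hi => by
      change i ∈ s'.G k.val at hi
      rw [hG, Finset.mem_insert] at hi
      rcases hi with rfl | hi
      · exact ⟨hkN, hkidx.ge, hk.2⟩
      · exact (B.mem_G i hi).imp_right (And.imp_left le_of_lt)
    mem_G_iff := fun l hl i => by
      change k.val ≤ l at hl
      change i ∈ s'.G l ↔ i ∈ s'.G k.val ∧ l ≤ (s.R i).sig.idx.val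
      rcases eq_or_ne l k.val with rfl | hne
      · refine (and_iff_left_of_imp fun hi => ?_).symm
        rw [hG, Finset.mem_insert] at hi
        rcases hi with rfl | hi
        · exact hkidx.ge
        · exact (B.mem_G i hi).2.1.le
      · have hlt := lt_of_le_of_ne hl hne.symm
        rw [hGne l hne, hG, B.mem_G_iff l hlt i, Finset.mem_insert]
        refine and_congr_left fun hli => ⟨Or.inr, fun h => h.resolve_left ?_⟩
        rintro rfl
        rw [hkidx] at hli
        exact hlt.not_ge hli
    mem_ToDo := fun i hi => absurd hi (Finset.notMem_empty i)
    mem_Done := fun i hi => absurd hi (Finset.notMem_empty i)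
    cover := fun j hj hidx => by
      change k ≤ (s.R j).sig.idx at hidx
      change j ∈ s'.G k.val ∨ _
      rw [hG, Finset.mem_insert]
      rcases hidx.lt_or_eq with h | h
      · exact (B.cover j hj h).imp Or.inr fun h => Or.inr (Or.inr h)
      · rcases lt_or_ge j m with hjm | hjm
        · have := (B.input ⟨j, hjm⟩).1
          rw [this] at h
          exact Or.inl (Or.inl (by rw [h]))
        · exact absurd h (B.new_idx j hjm hj).ne
    homogeneous := B.homogeneous
    admissible := B.admissible
    waiting := fun c hc => by
      rcases hc with hc | hc
      · change c ∈ ⋃ r ∈ s.G (k.val + 1),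
          ({ s with call := k } : State n m K).critPair mo k.val r at hc
        simp only [Set.mem_iUnion] at hc
        obtain ⟨q, hq, hc⟩ := hc
        refine critPair_waiting hc ?_ ?_ ?_ rfl rfl hkidx.ge (B.mem_G q hq).2.1.le
        · rintro rfl
          exact hkG hq
        · change k.val ∈ s'.G k.val
          rw [hG]
          exact Finset.mem_insert_self _ _
        · change q ∈ s'.G k.val
          rw [hG]
          exact Finset.mem_insert_of_mem hq
      · exact absurd hc (Set.notMem_empty c)
    pairs := fun a ha b hb hab => by
      change a ∈ s'.G k.val at ha
      change b ∈ s'.G k.val at hb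
      rw [hG] at ha hb
      have key : ∀ q ∈ s.G (k.val + 1), s'.Superfluous mo (s.cofactor mo k.val q) k.val ∨
          s'.Superfluous mo (s.cofactor mo q k.val) q ∨
          ∃ c ∈ s'.P ∪ s'.Pd, c.Joins k.val q := by
        intro q hq
        refine (critPair_cover (s := { s with call := k }) (mo := mo) (r := k.val) (q := q)
          hkidx (B.mem_G q hq).2.1.le).imp
          (hS rfl rfl (fun _ _ => rfl) _ _ (Finset.mem_insert_self _ _))
          (Or.imp (hS rfl rfl (fun _ _ => rfl) _ _ (Finset.mem_insert_of_mem hq)) ?_)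
        rintro ⟨c, hc, hj⟩
        exact ⟨c, Or.inl (Set.mem_biUnion (x := q) hq hc), hj⟩
      rcases Finset.mem_insert.1 ha with rfl | ha'
      · exact key b ((Finset.mem_insert.1 hb).resolve_left hab.symm)
      · rcases Finset.mem_insert.1 hb with rfl | hb'
        · rcases key a ha' with h | h | ⟨c, hc, hj⟩
          · exact Or.inr (Or.inl h)
          · exact Or.inl h
          · exact Or.inr (Or.inr ⟨c, hc, hj.symm⟩)
        · exact (B.pairs a ha' b hb' hab).imp (hS rfl rfl (fun _ _ => rfl) _ _ ha)
            fun h => Or.inl (hS rfl rfl (fun _ _ => rfl) _ _ hb h)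
    irreducible := fun a ha => absurd ha (Finset.notMem_empty a)
    degrees := ⟨0, fun h => h.elim nofun nofun⟩
    loop := fun _ => ⟨rfl, rfl, rfl⟩
    spol := nofun
    reduction := nofun
    update := nofun }

theorem beforeCall_start (hF0 : ∀ i, F i ≠ 0) (hD : ∀ i, (F i).IsHomogeneous (D i)) {k : Fin m}
    (hk : k.val + 1 = m) : BeforeCall mo F D (start mo F k) k := by
  have hR : ∀ j (h : j < m), (start mo F k).R j = ⟨⟨0, ⟨j, h⟩⟩, monic mo (F ⟨j, h⟩)⟩ :=
    fun j h => dif_pos h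
  exact {
    m_le := le_rfl
    input := fun i => by
      rw [hR i i.2]
      exact ⟨rfl, monic_ne_zero (hF0 i)⟩
    new_idx := fun j hj hjN => absurd hjN (not_lt.2 hj)
    mem_G := fun i hi => absurd hi (Finset.notMem_empty i)
    mem_G_iff := fun l _ i => iff_of_false (Finset.notMem_empty i)
      fun h => Finset.notMem_empty i h.1
    -- Vacuous: `k` is the last index.
    cover := fun j hj hidx => by
      have h1 : k.val < ((start mo F k).R j).sig.idx.val := hidx
      have h2 := ((start mo F k).R j).sig.idx.2
      omega
    homogeneous := fun j hj => by
      rw [hR j hj]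
      have := (hD ⟨j, hj⟩).C_mul (mo.leadingCoeff (F ⟨j, hj⟩))⁻¹
      simpa [Sig.wdeg, monic] using this
    admissible := fun j hj => by
      rw [hR j hj]
      refine ⟨(mo.leadingCoeff (F ⟨j, hj⟩))⁻¹, ?_, ?_⟩
      · simpa using hF0 ⟨j, hj⟩
      · simp [gen, monic, C_mul']
    pairs := fun a ha => absurd ha (Finset.notMem_empty a) }

namespace Invariant

/-- No pair is waiting at the end of a call, so every pair in its basis has a superfluous part. -/
theorem beforeCall (I : Invariant mo F D s) (hph : s.phase = Phase.loop) (hP : s.P = ∅) {k : Fin m}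
    (hk : k.val + 1 = s.call.val) : BeforeCall mo F D s k := by
  obtain ⟨hPd, hT, hDone⟩ := I.loop hph
  have hlt : ∀ i : Fin m, k < i ↔ s.call ≤ i := fun i => by
    rw [Fin.lt_def, Fin.le_def]
    omega
  exact {
    m_le := I.m_le
    input := I.input
    new_idx := fun j hj hjN => (hlt _).2 (I.new_idx j hj hjN)
    mem_G := by
      simp only [hlt, hk]
      exact I.mem_G
    mem_G_iff := fun l hl i => by
      rw [hk]
      exact I.mem_G_iff l (by omega) i
    cover := fun j hj hidx => by
      have := I.cover j hj ((hlt _).1 hidx)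
      simpa [hT, hDone, hk] using this
    homogeneous := I.homogeneous
    admissible := I.admissible
    pairs := fun a ha b hb hab => by
      rw [hk] at ha hb
      have := I.pairs a ha b hb hab
      simpa [hP, hPd] using this }

theorem wdeg_eq {i : ℕ} (I : Invariant mo F D s) (hi : i < s.N) (h0 : (s.R i).poly ≠ 0) :
    (mo.degree (s.R i).poly).degree = Sig.wdeg D (s.R i).sig :=
  degree_degree (I.homogeneous i hi) h0

/-- Elements of `G_{k+1}` have larger index than `r_h`, so reducing by them changes `r_h` only below
its signature. They are not overwritten, so the result stays irreducible. -/
theorem take (I : Invariant mo F D s) {h : ℕ} {s₁ : State n m K} (ht : s.Take mo h s₁) :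
    Invariant mo F D s₁ ∧ h ∈ s₁.ToDo ∧ s₁.phase = Phase.reduction ∧ s₁.ToDo = s.ToDo ∧
      s₁.Done = s.Done ∧ ∀ q, ¬ RedStep mo (s₁.polys (s₁.call.val + 1)) (s₁.R h).poly q := by
  obtain ⟨hph, hh, -, p, hp, rfl⟩ := ht
  obtain ⟨-, hN, hidx, -⟩ := I.mem_ToDo h hh
  have hmem : ∀ i ∈ s.G (s.call.val + 1), i ∈ s.basis ∧ s.call < (s.R i).sig.idx := fun i hi =>
    ⟨I.subset_basis (Nat.le_succ _) hi, ((I.mem_G_iff _ (Nat.le_succ _) i).1 hi).2⟩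
  have h1 := hp.preserves (F := F) (σ := (s.R h).sig) (d := Sig.wdeg D (s.R h).sig) (by
    rintro _ ⟨i, hi, rfl⟩
    have hiN := I.lt_of_mem_basis (hmem i hi).1
    exact ⟨s.R i, rfl, I.admissible i hiN, by rw [hidx]; exact (hmem i hi).2,
      _, I.homogeneous i hiN⟩) (I.admissible h hN) (I.homogeneous h hN)
  refine ⟨I.setPoly hh h1.1 h1.2, hh, hph, rfl, rfl, ?_⟩
  have h2 : (s.setPoly h p).polys ((s.setPoly h p).call.val + 1) = s.polys (s.call.val + 1) := by
    ext q
    refine exists_congr fun i => and_congr_right fun hi => ?_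
    rw [setPoly_of_ne]
    rintro rfl
    exact I.not_mem_basis hh (hmem i hi).1
  rw [h2, setPoly_self]
  exact hp.2

/-- If `r_h` has no reductor, then its pairs with basis elements whose head monomial divides that
of `r_h` have a superfluous part. -/
theorem irreducible_of_not_isReductor (I : Invariant mo F D s) {h : ℕ} (hh : h ∈ s.ToDo)
    (h0 : (s.R h).poly ≠ 0)
    (hnf : ∀ q, ¬ RedStep mo (s.polys (s.call.val + 1)) (s.R h).poly q)
    (hred : ∀ j, ¬ s.IsReductor mo h j) {b : ℕ} (hb : b ∈ s.basis)
    (hle : mo.degree (s.R b).poly ≤ mo.degree (s.R h).poly) :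
    s.Superfluous mo (mo.degree (s.R h).poly - mo.degree (s.R b).poly) b ∨
      s.Superfluous mo 0 h := by
  by_contra! H
  obtain ⟨H1, H2⟩ := H
  have hbN := I.lt_of_mem_basis hb
  have hT := I.mem_ToDo h hh
  -- For larger index, `b` would reduce a polynomial already in normal form. For equal index, a
  -- failing check of `IsReductor` is one of the criteria, or two signatures agree and the older
  -- element is rewritten.
  rcases (I.idx_of_mem_basis hb).lt_or_eq with hlt | heq
  · have hbG : b ∈ s.G (s.call.val + 1) :=
      (I.mem_G_iff _ (Nat.le_succ _) b).2 ⟨I.mem_G_of_lt_idx hb hlt, hlt⟩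
    refine hnf _ ⟨_, ⟨b, hbG, rfl⟩, I.poly_ne_zero hb,
      mo.degree (s.R h).poly - mo.degree (s.R b).poly, ?_, rfl⟩
    rw [tsub_add_cancel_of_le hle]
    exact mo.degree_mem_support h0
  · refine hred b ⟨hb, hle, ?_, fun h => H1 (Or.inr h), fun e => ?_⟩
    · by_contra h
      exact H1 (Or.inl (by rw [SatisfiesF5, ← heq]; exact h))
    · rw [← Sig.mul_zero (s.R h).sig] at e
      have hne : b ≠ h := by
        rintro rfl
        exact I.not_mem_basis hh hb
      exact (rewritten_of_sig_eq hne hbN hT.2.1 e).elim (fun h => H1 (Or.inr h))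
        fun h => H2 (Or.inr h)

theorem addToDone (I : Invariant mo F D s) {h : ℕ} (ha : s.AddToDone mo h s') :
    Invariant mo F D s' := by
  obtain ⟨s₁, ht, h0, hred, rfl⟩ := ha
  obtain ⟨I₁, hh, hph, hT, hDone, hnf⟩ := I.take ht
  rw [← hT, ← hDone]
  have hN := (I₁.mem_ToDo h hh).2.1
  have hm := monic_ne_zero (mo := mo) h0
  have hirr := fun b hb hle => I₁.irreducible_of_not_isReductor hh h0 hnf hred (b := b) hb hle
  have hR : ∀ j ∈ s₁.basis, (s₁.setPoly h (monic mo (s₁.R h).poly)).R j = s₁.R j := fun j hj =>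
    setPoly_of_ne _ (by rintro rfl; exact I₁.not_mem_basis hh hj)
  have I₂ := I₁.setPoly hh (p := monic mo (s₁.R h).poly)
    ((I₁.admissible h hN).C_mul (by simpa using h0)) ((I₁.homogeneous h hN).C_mul _)
  have hS : ∀ u, ∀ i < s₁.N, s₁.call ≤ (s₁.R i).sig.idx → s₁.Superfluous mo u i →
      (s₁.setPoly h (monic mo (s₁.R h).poly)).Superfluous mo u i :=
    fun u i hi hidx => I₁.superfluous_mono hi hidx le_rfl
      (fun j _ => setPoly_sig _ _ j) (fun _ _ => rfl) (fun j hj => by rw [hR j hj])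
  refine I₂.finish hh ?_ hph ?_
  · rw [setPoly_self]
    exact hm
  · intro b hb hle
    rw [hR b hb, setPoly_self] at hle ⊢
    simp only [degree_monic h0] at hle ⊢
    exact (hirr b hb hle).imp (hS _ b (I₁.lt_of_mem_basis hb) (I₁.idx_of_mem_basis hb))
      (hS _ h hN (I₁.mem_ToDo h hh).2.2.1.ge)

theorem reduceSafe (I : Invariant mo F D s) {h j : ℕ} (hh : h ∈ s.ToDo) (h0 : (s.R h).poly ≠ 0)
    (hj : s.IsReductor mo h j)
    (hsafe : Sig.Lt mo (Sig.mul (ratio mo (s.R h) (s.R j)) (s.R j).sig) (s.R h).sig) :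
    Invariant mo F D (s.setPoly h (s.spoly mo 0 h (ratio mo (s.R h) (s.R j)) j)) := by
  have hN := (I.mem_ToDo h hh).2.1
  have hjN := I.lt_of_mem_basis hj.1
  have h1 := (I.admissible h hN).spoly (I.admissible j hjN) (u := 0)
    (v := ratio mo (s.R h) (s.R j))
    (mo.leadingCoeff (s.R h).poly / mo.leadingCoeff (s.R j).poly) (by rwa [Sig.mul_zero])
  have h2 := isHomogeneous_spoly (mo := mo) (I.homogeneous h hN) (I.homogeneous j hjN) h0
    (I.poly_ne_zero hj.1) (u := 0) (v := ratio mo (s.R h) (s.R j))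
    (mo.leadingCoeff (s.R h).poly / mo.leadingCoeff (s.R j).poly)
    (by rw [zero_add, ratio, tsub_add_cancel_of_le hj.2.1])
  rw [Sig.mul_zero] at h1 h2
  exact I.setPoly hh h1 h2

theorem reduceSpawn (I : Invariant mo F D s) (hph : s.phase = Phase.reduction) {h j : ℕ}
    (hh : h ∈ s.ToDo) (h0 : (s.R h).poly ≠ 0) (hj : s.IsReductor mo h j)
    (hns : ¬ Sig.Lt mo (Sig.mul (ratio mo (s.R h) (s.R j)) (s.R j).sig) (s.R h).sig) :
    Invariant mo F D (s.append ⟨Sig.mul (ratio mo (s.R h) (s.R j)) (s.R j).sig,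
      s.spoly mo (ratio mo (s.R h) (s.R j)) j 0 h⟩) := by
  have hT := I.mem_ToDo h hh
  have hN := hT.2.1
  have hjN := I.lt_of_mem_basis hj.1
  -- Check (d) of `IsReductor` excludes equal signatures, so the signature of the new element does
  -- come from the reductor.
  have hlt := (Sig.lt_or_eq_of_not_lt hns).resolve_right fun e => hj.2.2.2.2 e.symm
  have hsum : ratio mo (s.R h) (s.R j) + mo.degree (s.R j).poly = mo.degree (s.R h).poly := by
    rw [ratio, tsub_add_cancel_of_le hj.2.1]
  refine I.append ?_ ((I.admissible j hjN).spoly (I.admissible h hN) _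
    (by rwa [Sig.mul_zero])) (isHomogeneous_spoly (mo := mo) (I.homogeneous j hjN)
      (I.homogeneous h hN) (I.poly_ne_zero hj.1) h0 _ (by rw [zero_add, hsum])) (Or.inr hph)
    (Or.inr ⟨h, hh, ?_⟩)
  · have := Sig.idx_le_of_not_lt hlt.asymm
    rw [hT.2.2.1] at this
    exact le_antisymm this (I.idx_of_mem_basis hj.1)
  · rw [Sig.wdeg_mul, ← I.wdeg_eq (mo := mo) hN h0, ← I.wdeg_eq hjN (I.poly_ne_zero hj.1),
      ← map_add, hsum]

theorem spolCompute (I : Invariant mo F D s) {c : CritPair n} (hph : s.phase = Phase.spol)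
    (hc : c ∈ s.Pd) (hrew₁ : ¬ s.SatisfiesRewritten c.u₁ c.pos₁)
    (hrew₂ : ¬ s.SatisfiesRewritten c.u₂ c.pos₂) :
    Invariant mo F D { s.append ⟨Sig.mul c.u₁ (s.R c.pos₁).sig,
      s.spoly mo c.u₁ c.pos₁ c.u₂ c.pos₂⟩ with Pd := s.Pd \ {c} } := by
  have hw := I.waiting c (Or.inr hc)
  obtain ⟨hN₁, -, h01⟩ := I.mem_G _ hw.mem₁
  obtain ⟨hN₂, -, h02⟩ := I.mem_G _ hw.mem₂
  have hsum₁ : c.u₁ + mo.degree (s.R c.pos₁).poly = c.lcm := by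
    rw [hw.cof₁, hw.lcm_eq, cofactor, tsub_add_cancel_of_le le_sup_left]
  have hsum₂ : c.u₂ + mo.degree (s.R c.pos₂).poly = c.lcm := by
    rw [hw.cof₂, hw.lcm_eq, cofactor, sup_comm, tsub_add_cancel_of_le le_sup_right]
  -- With equal signatures one part would be rewritten, and `Spol` would have rejected the pair.
  have hlt : Sig.Lt mo (Sig.mul c.u₂ (s.R c.pos₂).sig) (Sig.mul c.u₁ (s.R c.pos₁).sig) :=
    (Sig.lt_or_eq_of_not_lt hw.not_lt).resolve_right fun e =>
      (rewritten_of_sig_eq hw.ne.symm hN₂ hN₁ e).elim hrew₂ hrew₁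
  have I' := I.append (r := ⟨Sig.mul c.u₁ (s.R c.pos₁).sig,
    s.spoly mo c.u₁ c.pos₁ c.u₂ c.pos₂⟩) hw.idx₁
    ((I.admissible _ hN₁).spoly (I.admissible _ hN₂) _ hlt)
    (isHomogeneous_spoly (mo := mo) (I.homogeneous _ hN₁) (I.homogeneous _ hN₂) h01 h02 _
      (hsum₁.trans hsum₂.symm)) (Or.inl hph)
    (Or.inl ⟨c, hc, by
      rw [Sig.wdeg_mul, ← I.wdeg_eq (mo := mo) hN₁ h01, ← map_add, hsum₁]⟩)
  -- The S-polynomial just appended has the signature of the first part, so it rewrites that part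
  -- and the pair becomes superfluous.
  refine I'.removePair hc hph (Or.inl ⟨s.N, hN₁, Nat.lt_succ_self _, ?_⟩)
  rw [append_self, append_of_ne _ hN₁.ne]
  exact ⟨rfl, le_rfl⟩

theorem step (I : Invariant mo F D s) (h : Step mo s s') : Invariant mo F D s' := by
  cases h with
  | select d hph hd hmin =>
    obtain ⟨hPd, hT, hDone⟩ := I.loop hph
    have := I.schedule (ph := Phase.spol) (P := {c ∈ s.P | c.lcm.degree ≠ d})
      (Pd := {c ∈ s.P | c.lcm.degree = d})
      (by
        ext c
        simp only [hPd, Set.union_empty, Set.mem_union, Set.mem_ofPred_eq, ← and_or_left]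
        exact and_iff_left (ne_or_eq _ _))
      (fun _ => ⟨d, fun c hc => lt_of_le_of_ne (hmin c hc.1) hc.2.symm, fun c hc => hc.2,
        by simp [hT], by simp [hDone]⟩)
      nofun (fun _ => hDone) nofun nofun
    rwa [hT, hDone] at this
  | spolReject c hph hc hrew => exact I.removePair hc hph hrew
  | spolCompute c hph hc h1 h2 => exact I.spolCompute hph hc h1 h2
  | spolReturn hph hPd =>
    obtain ⟨d, hd⟩ := I.degrees
    exact I.schedule (ph := Phase.reduction) rfl (fun _ => ⟨d, hd (Or.inl hph)⟩) nofun nofun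
      (fun _ => hPd) nofun
  | reduceZero s₁ h ht h0 =>
    obtain ⟨I₁, hh, hph, hT, -, -⟩ := I.take ht
    rw [← hT]
    exact I₁.drop h0 hph
  | addToDone _ _ ha => exact I.addToDone ha
  | reduceSafe s₁ h j ht h0 hj hsafe =>
    obtain ⟨I₁, hh, -⟩ := I.take ht
    exact I₁.reduceSafe hh h0 hj hsafe
  | reduceSpawn s₁ h j ht h0 hj hns =>
    obtain ⟨I₁, hh, hph, -⟩ := I.take ht
    exact I₁.reduceSpawn hph hh h0 hj hns
  | reductionReturn hph hT =>
    exact I.schedule (ph := Phase.update) rfl (fun h => h.elim nofun nofun) nofun nofun nofun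
      (fun _ => ⟨I.reduction hph, hT⟩)
  | update r hph hr => exact I.enlarge hph hr
  | updateReturn hph hD =>
    exact I.schedule (ph := Phase.loop) rfl (fun h => h.elim nofun nofun)
      (fun _ => ⟨(I.update hph).1, (I.update hph).2, hD⟩) nofun nofun nofun
  | nextCall k hph hP hk h1 => exact (I.beforeCall hph hP hk).enterCall

end Invariant

theorem invariant_of_reachable (hF0 : ∀ i, F i ≠ 0) (hD : ∀ i, (F i).IsHomogeneous (D i))
    (h : Reachable mo F s) : Invariant mo F D s := by
  induction h with
  | init k hk => exact (beforeCall_start hF0 hD hk).enterCall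
  | step s s' _ hstep ih => exact ih.step hstep

end State

end F5

/-! ### Good multiples below the minimal signature in `ToDo`. -/

namespace F5

open MvPolynomial

namespace State

variable {n m : ℕ} {K : Type*} [Field K] {mo : MonomialOrder (Fin n)}
  {F : Fin m → MvPolynomial (Fin n) K} {D : Fin m → ℕ} {s : State n m K}

/-- The multiples of basis elements that satisfy neither criterion and whose signature is at
most `τ`. -/
def goodMultiples (mo : MonomialOrder (Fin n)) (s : State n m K) (τ : Sig n m) :
    Set (MvPolynomial (Fin n) K) :=
  {p | ∃ l ∈ s.basis, ∃ u, ¬ s.Superfluous mo u l ∧ ¬ Sig.Lt mo τ (Sig.mul u (s.R l).sig) ∧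
    p = monomial u 1 * (s.R l).poly}

theorem goodMultiples_mono {τ σ : Sig n m} (h : ¬ Sig.Lt mo σ τ) :
    s.goodMultiples mo τ ⊆ s.goodMultiples mo σ :=
  fun _ ⟨l, hl, u, hu, hlt, e⟩ => ⟨l, hl, u, hu, Sig.not_lt_trans hlt h, e⟩

namespace Invariant

variable (I : Invariant mo F D s)

include I

/-- Below the signatures in `ToDo` everything is a combination of multiples of basis elements that
satisfy neither criterion. -/
theorem gen_mem_span_goodMultiples (hcall : s.call.val = 0) {σ : Sig n m}
    (hmin : ∀ j ∈ s.ToDo, ¬ Sig.Lt mo (s.R j).sig σ) (τ : Sig n m) (hτ : Sig.Lt mo τ σ) :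
    gen F τ ∈ Submodule.span K (s.goodMultiples mo τ) := by
  classical
  induction τ using (Sig.lt_wellFounded (mo := mo)).induction with
  | _ τ ih =>
  have hbelow : below mo F τ ≤ Submodule.span K (s.goodMultiples mo τ) := by
    refine Submodule.span_le.2 ?_
    rintro _ ⟨ρ, hρ, rfl⟩
    exact Submodule.span_mono (goodMultiples_mono hρ.asymm) (ih ρ hρ (hρ.trans hτ))
  have hcover : ∀ a : Fin m, s.call ≤ a := fun a => by
    rw [Fin.le_def, hcall]
    exact Nat.zero_le _
  -- The input with the index of `τ` has a signature dividing `τ`. The largest such position is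
  -- chosen so that nothing rewrites it.
  have hne : ((Finset.range s.N).filter fun j => Sig.Dvd (s.R j).sig τ).Nonempty := by
    refine ⟨τ.idx.val, Finset.mem_filter.2 ⟨Finset.mem_range.2 (τ.idx.2.trans_le I.m_le), ?_⟩⟩
    rw [(I.input τ.idx).1]
    exact ⟨rfl, zero_le⟩
  obtain ⟨j, hj, hmax⟩ := Finset.exists_max_image _ id hne
  obtain ⟨hjN, hdvd⟩ := Finset.mem_filter.1 hj
  rw [Finset.mem_range] at hjN
  have hmul := Sig.mul_sub_of_dvd hdvd
  set u := τ.mon - (s.R j).sig.mon with hu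
  obtain ⟨c, hc, hadm⟩ := (I.admissible j hjN).mul u
  simp only [hmul] at hadm
  -- Modulo smaller signatures this multiple is `c • gen F τ` with `c ≠ 0`, and smaller signatures
  -- are covered by induction.
  suffices h : monomial u 1 * (s.R j).poly ∈ Submodule.span K (s.goodMultiples mo τ) by
    have := sub_mem h (hbelow hadm)
    rw [sub_sub_cancel] at this
    exact (Submodule.smul_mem_iff _ hc).1 this
  by_cases hF5 : s.SatisfiesF5 mo u j
  · rw [SatisfiesF5, not_fixedByNF_iff, hmul, hdvd.1] at hF5
    obtain ⟨i, hi, h0, hle⟩ := hF5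
    have hcτ : s.call.val ≤ τ.idx.val + 1 := by omega
    have hib := I.subset_basis hcτ hi
    have hgen := gen_mem_below_of_head_le (I.admissible i (I.lt_of_mem_basis hib)) h0
      (τ := τ) ((I.mem_G_iff _ hcτ i).1 hi).2 hle
    have := add_mem hadm (Submodule.smul_mem _ c hgen)
    rw [sub_add_cancel] at this
    exact hbelow this
  have hb : j ∈ s.basis → monomial u 1 * (s.R j).poly ∈
      Submodule.span K (s.goodMultiples mo τ) := fun hb => by
    refine Submodule.subset_span ⟨j, hb, u, ?_, by rw [hmul]; exact Sig.not_lt_self τ, rfl⟩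
    rintro (h | ⟨i, hji, hiN, hd⟩)
    · exact hF5 h
    · rw [hmul] at hd
      exact (hmax i (Finset.mem_filter.2 ⟨Finset.mem_range.2 hiN, hd⟩)).not_gt hji
  rcases I.cover j hjN (hcover _) with h | h | h | h
  · exact hb (Finset.mem_union_left _ h)
  · exact hb (Finset.mem_union_right _ h)
  · exact absurd (Sig.lt_of_not_lt_of_lt (Sig.not_lt_of_dvd hdvd) hτ) (hmin j h)
  · simp [h]

/-- During a reduction, a pair of basis elements of degree at most the current one has a
superfluous part. -/
theorem pair_superfluous (hph : s.phase = Phase.reduction) {g : ℕ} (hg : g ∈ s.ToDo) {a b : ℕ}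
    (ha : a ∈ s.basis) (hb : b ∈ s.basis) (hab : a ≠ b)
    (hdeg : (s.R a).sig.idx = s.call ∨ (s.R b).sig.idx = s.call →
      (mo.degree (s.R a).poly ⊔ mo.degree (s.R b).poly).degree ≤ Sig.wdeg D (s.R g).sig) :
    s.Superfluous mo (s.cofactor mo a b) a ∨ s.Superfluous mo (s.cofactor mo b a) b := by
  obtain ⟨d, hd⟩ := I.degrees
  obtain ⟨hP, -, hT, hDone⟩ := hd (Or.inr hph)
  rw [hT g hg] at hdeg
  have key : ∀ a ∈ s.Done, ∀ b ∈ s.basis, a ≠ b →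
      (mo.degree (s.R a).poly ⊔ mo.degree (s.R b).poly).degree ≤ d →
      s.Superfluous mo (s.cofactor mo a b) a ∨ s.Superfluous mo (s.cofactor mo b a) b := by
    intro a ha b hb hab hdeg
    -- The head monomial of `a` already has degree `d`, so an lcm of degree at most `d` must equal
    -- it.
    have hle : mo.degree (s.R b).poly ≤ mo.degree (s.R a).poly := by
      obtain ⟨x, hx⟩ := exists_add_of_le
        (le_sup_left : mo.degree (s.R a).poly ≤ mo.degree (s.R a).poly ⊔ mo.degree (s.R b).poly)
      have h1 := I.wdeg_eq (mo := mo) (I.mem_Done a ha).1 (I.mem_Done a ha).2.2.2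
      rw [hDone a ha] at h1
      rw [hx, map_add, h1] at hdeg
      have : x = 0 := (Finsupp.degree_eq_zero_iff x).1 (by omega)
      rw [this, add_zero] at hx
      exact sup_eq_left.1 hx
    have := I.irreducible a ha b hb hab hle
    rw [cofactor, cofactor, sup_eq_left.2 hle, sup_eq_right.2 hle, tsub_self]
    exact this.symm
  have ha' := ha
  have hb' := hb
  rw [basis, Finset.mem_union] at ha' hb'
  rcases ha' with ha' | ha'
  · rcases hb' with hb' | hb'
    · rcases I.pairs a ha' b hb' hab with h | h | ⟨c, hc, hj⟩
      · exact Or.inl h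
      · exact Or.inr h
      -- Waiting pairs have degree above `d`, and their first part has the index of the call, which
      -- makes `hdeg` available.
      · exfalso
        have hw := I.waiting c hc
        have hlcm := hw.lcm_eq
        have hidx := hw.idx₁
        rw [I.reduction hph, Set.union_empty] at hc
        have h1 := hP c hc
        rcases hj with ⟨h2, h3⟩ | ⟨h2, h3⟩
        · rw [h2, h3] at hlcm
          rw [h2] at hidx
          rw [hlcm] at h1
          exact h1.not_ge (hdeg (Or.inl hidx))
        · rw [h2, h3, sup_comm] at hlcm
          rw [h2] at hidx
          rw [hlcm] at h1
          exact h1.not_ge (hdeg (Or.inr hidx))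
    · refine (key b hb' a ha hab.symm ?_).symm
      rw [sup_comm]
      exact hdeg (Or.inr (I.mem_Done b hb').2.1)
  · exact key a ha' b hb hab (hdeg (Or.inl (I.mem_Done a ha').2.1))

/-- During a reduction, multiples that satisfy neither criterion have distinct head monomials. -/
theorem eq_of_degree_eq (hph : s.phase = Phase.reduction) {g : ℕ} (hg : g ∈ s.ToDo) {a b : ℕ}
    {u v : Fin n →₀ ℕ} (ha : a ∈ s.basis) (hb : b ∈ s.basis) (hu : ¬ s.Superfluous mo u a)
    (hv : ¬ s.Superfluous mo v b)
    (hdeg : (s.R a).sig.idx = s.call ∨ (s.R b).sig.idx = s.call →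
      Sig.wdeg D (Sig.mul u (s.R a).sig) ≤ Sig.wdeg D (s.R g).sig)
    (h : u + mo.degree (s.R a).poly = v + mo.degree (s.R b).poly) : a = b := by
  by_contra hab
  -- The common head monomial is a multiple of the lcm, so `u` and `v` are multiples of the two
  -- cofactors.
  have h1 : mo.degree (s.R a).poly ⊔ mo.degree (s.R b).poly ≤ u + mo.degree (s.R a).poly :=
    sup_le (by simp) (by rw [h]; simp)
  have h2 : mo.degree (s.R a).poly ⊔ mo.degree (s.R b).poly ≤ v + mo.degree (s.R b).poly :=
    h ▸ h1
  refine (I.pair_superfluous (mo := mo) hph hg ha hb hab fun hi => le_trans ?_ (hdeg hi)).elim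
    (fun h => hu (superfluous_of_dvd ?_ h)) fun h => hv (superfluous_of_dvd ?_ h)
  · rw [Sig.wdeg_mul, ← I.wdeg_eq (mo := mo) (I.lt_of_mem_basis ha) (I.poly_ne_zero ha), ← map_add]
    obtain ⟨x, hx⟩ := exists_add_of_le h1
    rw [hx, map_add]
    exact Nat.le_add_right _ _
  · rw [cofactor]
    exact tsub_le_iff_right.2 h1
  · rw [cofactor, sup_comm]
    exact tsub_le_iff_right.2 h2

/-- A multiple of a basis element whose signature lies below all signatures in `ToDo` has the head
monomial of a multiple that satisfies neither criterion and has no greater signature. -/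
theorem exists_goodMultiple (hcall : s.call.val = 0) (hph : s.phase = Phase.reduction) {g : ℕ}
    (hg : g ∈ s.ToDo) (hmin : ∀ j ∈ s.ToDo, ¬ Sig.Lt mo (s.R j).sig (s.R g).sig) {i : ℕ}
    (hi : i ∈ s.basis) {u : Fin n →₀ ℕ}
    (hlt : Sig.Lt mo (Sig.mul u (s.R i).sig) (s.R g).sig)
    (hdeg : (s.R i).sig.idx = (s.R g).sig.idx →
      (Sig.mul u (s.R i).sig).mon.degree ≤ (s.R g).sig.mon.degree) :
    ∃ j ∈ s.basis, ∃ v, ¬ s.Superfluous mo v j ∧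
      ¬ Sig.Lt mo (Sig.mul u (s.R i).sig) (Sig.mul v (s.R j).sig) ∧
      v + mo.degree (s.R j).poly = u + mo.degree (s.R i).poly := by
  set σ := Sig.mul u (s.R i).sig with hσ
  set p := monomial u 1 * (s.R i).poly with hp
  have hiN := I.lt_of_mem_basis hi
  have hi0 := I.poly_ne_zero hi
  have hgidx := (I.mem_ToDo g hg).2.2.1
  have hp0 : p ≠ 0 := mul_ne_zero (by simp) hi0
  have hhom : ∀ l ∈ s.basis, ∀ v, (monomial v (1 : K) * (s.R l).poly).IsHomogeneous
      (Sig.wdeg D (Sig.mul v (s.R l).sig)) := fun l hl v => by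
    rw [Sig.wdeg_mul]
    exact isHomogeneous_monomial_mul (I.homogeneous l (I.lt_of_mem_basis hl)) v 1
  have hspan : p ∈ Submodule.span K (s.goodMultiples mo σ) := by
    obtain ⟨c, -, h⟩ := (I.admissible i hiN).mul u
    have hbelow : below mo F σ ≤ Submodule.span K (s.goodMultiples mo σ) := by
      refine Submodule.span_le.2 ?_
      rintro _ ⟨ρ, hρ, rfl⟩
      exact Submodule.span_mono (goodMultiples_mono hρ.asymm)
        (I.gen_mem_span_goodMultiples hcall hmin ρ (hρ.trans hlt))
    have := add_mem (hbelow h)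
      (Submodule.smul_mem _ c (I.gen_mem_span_goodMultiples hcall hmin σ hlt))
    rwa [sub_add_cancel] at this
  -- Good multiples of the degree of `p` suffice, by taking homogeneous components. This bounds the
  -- degrees of the critical pairs involved.
  set T : Set (MvPolynomial (Fin n) K) := {q | ∃ l ∈ s.basis, ∃ v, ¬ s.Superfluous mo v l ∧
    ¬ Sig.Lt mo σ (Sig.mul v (s.R l).sig) ∧
    Sig.wdeg D (Sig.mul v (s.R l).sig) = Sig.wdeg D σ ∧ q = monomial v 1 * (s.R l).poly} with hT
  have hspanT : p ∈ Submodule.span K T := by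
    have h1 : homogeneousComponent (Sig.wdeg D σ) p = p :=
      homogeneousComponent_eq_self (hhom i hi u)
    rw [← h1]
    have h2 := Submodule.mem_map_of_mem (f := homogeneousComponent (Sig.wdeg D σ)) hspan
    refine (Submodule.map_span_le _ _ _).2 ?_ h2
    rintro _ ⟨l, hl, v, hv, hle, rfl⟩
    rw [homogeneousComponent_of_mem (hhom l hl v)]
    split_ifs with e
    · exact Submodule.subset_span ⟨l, hl, v, hv, hle, e.symm, rfl⟩
    · exact zero_mem _
  have hdegT : ∀ l ∈ s.basis, ∀ v, mo.degree (monomial v (1 : K) * (s.R l).poly) =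
      v + mo.degree (s.R l).poly := fun l hl v =>
    degree_monomial_mul (I.poly_ne_zero hl) v one_ne_zero
  -- A multiple with the index of the call and signature at most `σ` forces `σ` to have that index
  -- too, which is the case covered by `hdeg`.
  have hlow : ∀ l v, (s.R l).sig.idx = s.call →
      ¬ Sig.Lt mo σ (Sig.mul v (s.R l).sig) → Sig.wdeg D σ ≤ Sig.wdeg D (s.R g).sig := by
    intro l v hl hle
    have h1 := Sig.idx_le_of_not_lt hle
    rw [Sig.mul_idx, Sig.mul_idx, hl] at h1
    have h2 : (s.R i).sig.idx = (s.R g).sig.idx := by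
      rw [hgidx]
      exact le_antisymm h1 (I.idx_of_mem_basis hi)
    have h3 := hdeg h2
    rw [Sig.wdeg, Sig.wdeg, hσ, Sig.mul_idx, h2]
    exact Nat.add_le_add_right h3 _
  obtain ⟨_, ⟨j, hj, v, hv, hle, -, rfl⟩, e⟩ := exists_degree_eq_of_mem_span (mo := mo) (T := T) (by
      rintro _ ⟨l, hl, v, -, -, -, rfl⟩
      exact mul_ne_zero (by simp) (I.poly_ne_zero hl)) (by
      rintro _ ⟨a, ha, v, hv, hva, hda, rfl⟩ _ ⟨b, hb, w, hw, hwb, hdb, rfl⟩ e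
      rw [hdegT a ha, hdegT b hb] at e
      have hab := I.eq_of_degree_eq (mo := mo) hph hg ha hb hv hw (fun h => by
        rw [hda]
        exact h.elim (fun h => hlow a v h hva) fun h => hlow b w h hwb) e
      subst hab
      rw [add_right_cancel e]) hp0 hspanT
  rw [hdegT j hj, hdegT i hi] at e
  exact ⟨j, hj, v, hv, hle, e⟩

end Invariant

end State

end F5

theorem mainTheorem5 {K : Type*} [Field K] {n m : ℕ} (mo : MonomialOrder (Fin n))
    (F : Fin m → MvPolynomial (Fin n) K) (hF0 : ∀ i, F i ≠ 0)
    (hFhom : ∀ i, ∃ d : ℕ, (F i).IsHomogeneous d)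
    -- `s` is the state of an execution, in the last call, in which `g` is about to enter `Done`
    (s s' : F5.State n m K) (hs : F5.Reachable mo F s) (hcall : s.call.val = 0)
    (g : ℕ) (hg : s.AddToDone mo g s')
    (f : F5.LabeledPoly n m K) (hf : f.poly ≠ 0)
    (i : ℕ) (hi : i ∈ s.basis) (hred : F5.SignatureSafeReductor mo f (s.R i))
    (hlt : F5.Sig.Lt mo (F5.Sig.mul (F5.ratio mo f (s.R i)) (s.R i).sig) (s.R g).sig)
    -- automatic for degree-compatible orders; needed for orders such as `lex`
    (hdeg : F5.DegreeCompatible mo ∨ ((s.R i).sig.idx = (s.R g).sig.idx →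
      (F5.Sig.mul (F5.ratio mo f (s.R i)) (s.R i).sig).mon.degree ≤ (s.R g).sig.mon.degree)) :
    ∃ j ∈ s.basis, F5.SignatureSafeReductor mo f (s.R j) ∧
      ¬ s.SatisfiesF5 mo (F5.ratio mo f (s.R j)) j ∧
      ¬ s.SatisfiesRewritten (F5.ratio mo f (s.R j)) j := by
  choose D hD using hFhom
  have I := F5.State.invariant_of_reachable hF0 hD hs
  obtain ⟨_, ⟨hph, hgT, hmin, -⟩, -⟩ := hg
  obtain ⟨-, hle, hsafe⟩ := hred
  have hdeg' : (s.R i).sig.idx = (s.R g).sig.idx →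
      (F5.Sig.mul (F5.ratio mo f (s.R i)) (s.R i).sig).mon.degree ≤ (s.R g).sig.mon.degree := by
    refine hdeg.elim (fun hc e => ?_) id
    -- For equal indices `hlt` compares the monomials, and a degree-compatible order forbids the
    -- smaller one to have greater degree.
    by_contra! h
    rcases hlt with h' | ⟨-, h'⟩
    · rw [F5.Sig.mul_idx, e] at h'
      exact lt_irrefl _ h'
    · exact (hc _ _ h).asymm h'
  obtain ⟨j, hj, v, hv, hvle, e⟩ :=
    I.exists_goodMultiple hcall hph hgT hmin hi hlt hdeg'
  have hsum : v + mo.degree (s.R j).poly = mo.degree f.poly := by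
    rw [e, F5.ratio, tsub_add_cancel_of_le hle]
  have hratio : F5.ratio mo f (s.R j) = v := by
    rw [F5.ratio, ← hsum, add_tsub_cancel_right]
  refine ⟨j, hj, ⟨I.poly_ne_zero hj, ?_, ?_⟩, ?_⟩
  · rw [← hsum]
    simp
  · rw [hratio]
    exact F5.Sig.lt_of_not_lt_of_lt hvle hsafe
  · rw [hratio]
    exact not_or.1 hv
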